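/- Let $\Delta=\{z\in\mathbb{C}:|z|<1\}$ and let $h,k,l$ be positive integers with $$\frac1h+\frac1k+\frac1l<1 .$$ Let $\mathcal{F}$ be a family of meromorphic functions on $\Delta$ such that, for every $f\in\mathcal{F}$, every pole of $f$ in $\Delta$ has multiplicity at least $h$, every zero of $f$ in $\Delta$ has multiplicity at least $k$, and every zero of $f-1$ in $\Delta$ has multiplicity at least $l$ (every zero of an identically vanishing function counts as having infinite multiplicity). Then $\mathcal{F}$ is normal in $\Delta$: every sequence in $\mathcal{F}$ has a subsequence that converges, uniformly on each compact subset of $\Delta$ with respect to the chordal metric $$\chi(z,w)=\frac{|z-w|}{\sqrt{1+|z|^2}\,\sqrt{1+|w|^2}},\qquad \chi(z,\infty)=\frac1{\sqrt{1+|z|^2}},\qquad \chi(\infty,\infty)=0,$$ to some function $g:\Delta\to\mathbb{C}\cup\{\infty\}$. -/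

import Mathlib

/-- Chordal distance on the extended plane `ℂ ∪ {∞}`: the Euclidean distance between the
stereographic images on the sphere of diameter `1`. -/
noncomputable def chordalDist : OnePoint ℂ → OnePoint ℂ → ℝ
  | some z, some w => ‖z - w‖ / (Real.sqrt (1 + ‖z‖ ^ 2) * Real.sqrt (1 + ‖w‖ ^ 2))
  | some z, none => 1 / Real.sqrt (1 + ‖z‖ ^ 2)
  | none, some w => 1 / Real.sqrt (1 + ‖w‖ ^ 2)
  | none, none => 0

open Classical in
/-- The value in `ℂ ∪ {∞}` at `z` of a function that is meromorphic at `z`: it is `∞` at a pole,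
and the value of the holomorphic extension at every other point. (Mathlib's notion of a
meromorphic function puts no condition on the value `f z` itself.) -/
noncomputable def sphereValue (f : ℂ → ℂ) (z : ℂ) : OnePoint ℂ :=
  if meromorphicOrderAt f z < 0 then OnePoint.infty
  else ((toMeromorphicNFAt f z z : ℂ) : OnePoint ℂ)

/-- A family of meromorphic functions on `Ω` is normal if every sequence in it has a subsequence
that converges spherically uniformly on the compact subsets of `Ω` to some function
`g : Ω → ℂ ∪ {∞}`. -/
def IsNormalFamily (F : Set (ℂ → ℂ)) (Ω : Set ℂ) : Prop :=
  ∀ f : ℕ → ℂ → ℂ, (∀ n, f n ∈ F) →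
    ∃ φ : ℕ → ℕ, StrictMono φ ∧ ∃ g : ℂ → OnePoint ℂ,
      ∀ K ⊆ Ω, IsCompact K → ∀ ε > 0, ∃ N : ℕ, ∀ n > N, ∀ z ∈ K,
        chordalDist (sphereValue (f (φ n)) z) (g z) < ε

/-! The proof is Ahlfors' method with an explicit singular metric. Since the three reciprocals sum
to less than 1, there are a > 1/k, b > 1/l, c > 1/h and s > 0 with a + b + c + 4sA = 1 (A = 1
suffices). The metric |w|^(a-1) |w-1|^(b-1) (1+|w|^(2s))^A (1+|w-1|^(2s))^A |dw| then has cone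
angles 2πa, 2πb, 2πc at 0, 1, ∞. Its curvature is at most a negative constant
(`exists_coneDensity_sq_le`), and it dominates the spherical metric (`exists_inv_le_coneDensity`).
Pulling back by f multiplies a cone angle by the multiplicity. As ka, lb, hc > 1, the pulled-back
density is continuous and vanishes over 0, 1, ∞ (`IsRamifiedAt.continuousAt_pullbackDensity`). Its
product with R² - |z|² is therefore maximal at an unramified point, where negative curvature bounds
it (`pullbackDensity_mul_le`). So the family is uniformly spherically Lipschitz on smaller discs,
and Arzelà–Ascoli on the sphere concludes. No Laplacian is computed: near a point each factor is the
modulus of an analytic function times 1 plus a quadratic term, and the maximum modulus principle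
disposes of the analytic part. -/

open Filter Topology

/-! ### Local factorizations and the second-order test at a maximum -/

/-- Locally, a real power of the modulus of a nonvanishing analytic function is the modulus of an
analytic function. -/
lemma AnalyticAt.exists_norm_eq_rpow {f : ℂ → ℂ} {x : ℂ} (hf : AnalyticAt ℂ f x) (h0 : f x ≠ 0)
    (s : ℝ) : ∃ g : ℂ → ℂ, AnalyticAt ℂ g x ∧ (∀ z, ‖g z‖ = ‖f z‖ ^ s) ∧
      ‖deriv g x‖ = |s| * ‖f x‖ ^ (s - 1) * ‖deriv f x‖ := by
  have hpos : 0 < ‖f x‖ := norm_pos_iff.2 h0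
  -- Dividing by `f x` moves the base to 1, where the principal branch of the power is analytic; a
  -- real constant restores the modulus.
  have hslit : f x / f x ∈ Complex.slitPlane := by
    rw [div_self h0]; exact Complex.one_mem_slitPlane
  have hd : HasDerivAt (fun z => f z / f x) (deriv f x / f x) x :=
    hf.differentiableAt.hasDerivAt.div_const _
  refine ⟨fun z => ((‖f x‖ ^ s : ℝ) : ℂ) * (f z / f x) ^ (s : ℂ), ?_, fun z => ?_, ?_⟩
  · exact analyticAt_const.mul ((hf.div analyticAt_const h0).cpow analyticAt_const hslit)
  · rw [norm_mul, Complex.norm_cpow_real, norm_div, Complex.norm_real, Real.norm_eq_abs,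
      abs_of_nonneg (by positivity), ← Real.mul_rpow (by positivity) (by positivity)]
    congr 1
    field_simp
  · rw [((hd.cpow_const hslit).const_mul _).deriv, div_self h0]
    simp only [Complex.one_cpow, mul_one, norm_mul, norm_div, Complex.norm_real, Real.norm_eq_abs,
      abs_of_nonneg (Real.rpow_nonneg hpos.le s), Real.rpow_sub_one hpos.ne']
    ring

/-- Invariance of the spherical metric under the rotation w ↦ (w - c)/(1 + c̄w), which carries c to
0. -/
lemma one_add_norm_sq_eq (c w : ℂ) :
    (1 + ‖w‖ ^ 2) * (1 + ‖c‖ ^ 2) =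
      ‖1 + (starRingEnd ℂ) c * w‖ ^ 2 + ‖w - c‖ ^ 2 := by
  simp only [← Complex.normSq_eq_norm_sq, Complex.normSq_apply, Complex.add_re, Complex.add_im,
    Complex.mul_re, Complex.mul_im, Complex.conj_re, Complex.conj_im, Complex.one_re,
    Complex.one_im, Complex.sub_re, Complex.sub_im]
  ring

/-- The hyperbolic counterpart, for the automorphism of the disc of radius R carrying c to 0. -/
lemma sq_sub_norm_sq_eq (R : ℝ) (c w : ℂ) :
    (R ^ 2 - ‖w‖ ^ 2) * (R ^ 2 - ‖c‖ ^ 2) =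
      ‖(R : ℂ) ^ 2 - (starRingEnd ℂ) c * w‖ ^ 2 - ‖R * (w - c)‖ ^ 2 := by
  simp only [← Complex.normSq_eq_norm_sq, Complex.normSq_apply, Complex.mul_re,
    Complex.mul_im, Complex.conj_re, Complex.conj_im, Complex.ofReal_re,
    Complex.ofReal_im, Complex.sub_re, Complex.sub_im, pow_two (R : ℂ)]
  ring

/-- A power of `1 + |g|²`, `g` analytic, splits as the modulus of an analytic function times a
factor which is `1 + A |g'|² |z - x|² / (1 + |g x|²)² + ⋯`. -/
lemma AnalyticAt.exists_one_add_norm_sq_rpow {g : ℂ → ℂ} {x : ℂ} (hg : AnalyticAt ℂ g x) {A : ℝ}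
    (hA : 1 ≤ A) : ∃ Q G : ℂ → ℂ, AnalyticAt ℂ Q x ∧ Q x ≠ 0 ∧ AnalyticAt ℂ G x ∧ G x = 0 ∧
      ‖deriv G x‖ = ‖deriv g x‖ / (1 + ‖g x‖ ^ 2) ∧ (1 + ‖g x‖ ^ 2) ^ A = ‖Q x‖ ∧
      ∀ᶠ z in 𝓝 x, ‖Q z‖ * (1 + A * ‖G z‖ ^ 2) ≤ (1 + ‖g z‖ ^ 2) ^ A := by
  set c := g x with hc
  set D : ℂ → ℂ := fun z => 1 + (starRingEnd ℂ) c * g z with hD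
  have hDa : AnalyticAt ℂ D x := analyticAt_const.add (analyticAt_const.mul hg)
  have hDx : D x = ((1 + ‖c‖ ^ 2 : ℝ) : ℂ) := by
    simp only [hD, ← hc, Complex.conj_mul']
    push_cast; ring
  have hpos : 0 < 1 + ‖c‖ ^ 2 := by positivity
  have hDx0 : D x ≠ 0 := by rw [hDx]; exact_mod_cast hpos.ne'
  have hDn : ‖D x‖ = 1 + ‖c‖ ^ 2 := by
    rw [hDx, Complex.norm_real, Real.norm_eq_abs, abs_of_pos hpos]
  obtain ⟨P, hPa, hP, -⟩ := hDa.exists_norm_eq_rpow hDx0 (2 * A)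
  have hkey : ∀ z, D z ≠ 0 → 1 + ‖g z‖ ^ 2 =
      ‖D z‖ ^ 2 / (1 + ‖c‖ ^ 2) * (1 + ‖(g z - c) / D z‖ ^ 2) := by
    intro z hz
    have h1 := one_add_norm_sq_eq c (g z)
    have h2 : ‖D z‖ ≠ 0 := norm_ne_zero_iff.2 hz
    rw [norm_div]
    field_simp
    linarith
  have hsq : ∀ t : ℝ, 0 ≤ t → (t ^ 2) ^ A = t ^ (2 * A) := by
    intro t ht
    rw [← Real.rpow_natCast t 2, ← Real.rpow_mul ht]; norm_num
  refine ⟨fun z => P z / (((1 + ‖c‖ ^ 2) ^ A : ℝ) : ℂ), fun z => (g z - c) / D z, ?_, ?_, ?_, ?_,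
    ?_, ?_, ?_⟩
  · exact hPa.div analyticAt_const (by exact_mod_cast (Real.rpow_pos_of_pos hpos A).ne')
  · refine div_ne_zero ?_ (by exact_mod_cast (Real.rpow_pos_of_pos hpos A).ne')
    rw [← norm_ne_zero_iff, hP, hDn]
    exact (Real.rpow_pos_of_pos hpos _).ne'
  · exact (hg.sub analyticAt_const).div hDa hDx0
  · simp [← hc]
  · have := (hg.differentiableAt.hasDerivAt.sub_const c).div hDa.differentiableAt.hasDerivAt hDx0
    have h3 : deriv (fun z => (g z - c) / D z) x = deriv g x / D x := by
      erw [this.deriv]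
      rw [← hc, sub_self]
      field_simp
      ring
    rw [h3, norm_div, hDn]
  · rw [norm_div, hP, hDn, Complex.norm_real, Real.norm_eq_abs,
      abs_of_pos (Real.rpow_pos_of_pos hpos A), two_mul, Real.rpow_add hpos]
    field_simp
  · filter_upwards [hDa.continuousAt.eventually_ne hDx0] with z hz
    rw [hkey z hz, Real.mul_rpow (by positivity) (by positivity), Real.div_rpow (by positivity)
      hpos.le, hsq _ (norm_nonneg _), norm_div, hP, Complex.norm_real, Real.norm_eq_abs,
      abs_of_pos (Real.rpow_pos_of_pos hpos A)]
    refine mul_le_mul_of_nonneg_left ?_ (by positivity)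
    -- Bernoulli's inequality; this is where `1 ≤ A` is needed.
    exact one_add_mul_self_le_rpow_one_add (by nlinarith [sq_nonneg ‖(g z - c) / D z‖]) hA

/-- `R² - |z|²` is the modulus of an analytic function times `1 - |M|²`, `M` a Möbius map. -/
lemma exists_sq_sub_norm_sq {R : ℝ} {x : ℂ} (hx : ‖x‖ < R) : ∃ Q M : ℂ → ℂ, AnalyticAt ℂ Q x ∧
    Q x ≠ 0 ∧ AnalyticAt ℂ M x ∧ M x = 0 ∧ ‖deriv M x‖ = R / (R ^ 2 - ‖x‖ ^ 2) ∧
      ∀ᶠ z in 𝓝 x, R ^ 2 - ‖z‖ ^ 2 = ‖Q z‖ * (1 - ‖M z‖ ^ 2) := by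
  have hR : 0 < R := (norm_nonneg x).trans_lt hx
  have hpos : 0 < R ^ 2 - ‖x‖ ^ 2 := by nlinarith [norm_nonneg x]
  set D : ℂ → ℂ := fun z => (R : ℂ) ^ 2 - (starRingEnd ℂ) x * z with hD
  have hDa : AnalyticAt ℂ D x := analyticAt_const.sub (analyticAt_const.mul analyticAt_id)
  have hDx : D x = ((R ^ 2 - ‖x‖ ^ 2 : ℝ) : ℂ) := by
    simp only [hD, Complex.conj_mul']
    push_cast; ring
  have hDx0 : D x ≠ 0 := by rw [hDx]; exact_mod_cast hpos.ne'
  have hDn : ‖D x‖ = R ^ 2 - ‖x‖ ^ 2 := by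
    rw [hDx, Complex.norm_real, Real.norm_eq_abs, abs_of_pos hpos]
  refine ⟨fun z => D z ^ 2 / ((R ^ 2 - ‖x‖ ^ 2 : ℝ) : ℂ), fun z => R * (z - x) / D z, ?_, ?_, ?_,
    by simp, ?_, ?_⟩
  · exact (hDa.pow 2).div analyticAt_const (by exact_mod_cast hpos.ne')
  · exact div_ne_zero (pow_ne_zero _ hDx0) (by exact_mod_cast hpos.ne')
  · exact (analyticAt_const.mul (analyticAt_id.sub analyticAt_const)).div hDa hDx0
  · have := (((hasDerivAt_id x).sub_const x).const_mul (R : ℂ)).div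
      hDa.differentiableAt.hasDerivAt hDx0
    have h3 : deriv (fun z => R * (z - x) / D z) x = R / D x := by
      erw [this.deriv]
      simp only [id, sub_self]
      field_simp
      ring
    rw [h3, norm_div, hDn, Complex.norm_real, Real.norm_eq_abs, abs_of_pos hR]
  · filter_upwards [hDa.continuousAt.eventually_ne hDx0] with z hz
    have h1 := sq_sub_norm_sq_eq R x z
    have h2 : ‖D z‖ ≠ 0 := norm_ne_zero_iff.2 hz
    rw [norm_div, norm_div, Complex.norm_real, Real.norm_eq_abs, abs_of_pos hpos, norm_pow]
    field_simp
    linarith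

lemma tendsto_norm_sq_div_of_eq_zero {G : ℂ → ℂ} {x : ℂ} (hG : AnalyticAt ℂ G x) (h0 : G x = 0) :
    Tendsto (fun z => ‖G z‖ ^ 2 / ‖z - x‖ ^ 2) (𝓝[≠] x) (𝓝 (‖deriv G x‖ ^ 2)) := by
  have := (hasDerivAt_iff_tendsto_slope.1 hG.differentiableAt.hasDerivAt).norm.pow 2
  refine this.congr fun z => ?_
  rw [slope_def_field, h0, sub_zero, norm_div, div_pow]

/-- Second-order necessary condition at a local maximum, with the harmonic part of the logarithm
of the function removed by means of the maximum principle. -/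
lemma norm_deriv_sq_le_of_isLocalMax {V : ℂ → ℝ} {Q G₁ G₂ M : ℂ → ℂ} {x : ℂ} {A : ℝ} (hA : 0 ≤ A)
    (hV : IsLocalMax V x) (hVx : V x = ‖Q x‖) (hQ : AnalyticAt ℂ Q x) (hQx : Q x ≠ 0)
    (h₁ : AnalyticAt ℂ G₁ x) (h₁x : G₁ x = 0) (h₂ : AnalyticAt ℂ G₂ x) (h₂x : G₂ x = 0)
    (hM : AnalyticAt ℂ M x) (hMx : M x = 0)
    (hle : ∀ᶠ z in 𝓝 x, ‖Q z‖ * ((1 + A * ‖G₁ z‖ ^ 2) * (1 + A * ‖G₂ z‖ ^ 2) * (1 - ‖M z‖ ^ 2)) ≤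
      V z) :
    A * ‖deriv G₁ x‖ ^ 2 + A * ‖deriv G₂ x‖ ^ 2 ≤ ‖deriv M x‖ ^ 2 := by
  by_contra! hlt
  have t1 := tendsto_norm_sq_div_of_eq_zero h₁ h₁x
  have t2 := tendsto_norm_sq_div_of_eq_zero h₂ h₂x
  have t3 := tendsto_norm_sq_div_of_eq_zero hM hMx
  have c1 : Tendsto (fun z => ‖G₁ z‖ ^ 2) (𝓝[≠] x) (𝓝 0) := by
    have : ContinuousAt (fun z => ‖G₁ z‖ ^ 2) x := h₁.continuousAt.norm.pow 2
    simpa [h₁x] using this.tendsto.mono_left (nhdsWithin_le_nhds (s := {x}ᶜ))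
  have c2 : Tendsto (fun z => ‖G₂ z‖ ^ 2) (𝓝[≠] x) (𝓝 0) := by
    have : ContinuousAt (fun z => ‖G₂ z‖ ^ 2) x := h₂.continuousAt.norm.pow 2
    simpa [h₂x] using this.tendsto.mono_left (nhdsWithin_le_nhds (s := {x}ᶜ))
  -- This is the product in `hle` minus 1, divided by |z - x|², without its nonnegative term in
  -- |G₁|²|G₂|². A positive limit makes the product exceed 1 near x, so |Q| would have a strict
  -- local maximum.
  have t4 := ((t1.const_mul A).add (t2.const_mul A)).sub
    (t3.mul (((c1.const_mul A).const_add 1).mul ((c2.const_mul A).const_add 1)))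
  have hev := t4.eventually_const_lt (u := 0) (by simpa using hlt)
  have hstrict : ∀ᶠ z in 𝓝[≠] x, ‖Q z‖ < ‖Q x‖ := by
    filter_upwards [hev, self_mem_nhdsWithin, nhdsWithin_le_nhds hle, nhdsWithin_le_nhds hV,
      nhdsWithin_le_nhds (hQ.continuousAt.eventually_ne hQx)] with z h hz hle hmax hQz
    have hz' : 0 < ‖z - x‖ := norm_pos_iff.2 (sub_ne_zero.2 hz)
    have hQ' : 0 < ‖Q z‖ := norm_pos_iff.2 hQz
    rw [← hVx]
    refine lt_of_lt_of_le ?_ (hle.trans hmax)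
    refine lt_mul_of_one_lt_right hQ' ?_
    have h5 : 0 < (A * (‖G₁ z‖ ^ 2 / ‖z - x‖ ^ 2) + A * (‖G₂ z‖ ^ 2 / ‖z - x‖ ^ 2) -
        ‖M z‖ ^ 2 / ‖z - x‖ ^ 2 * ((1 + A * ‖G₁ z‖ ^ 2) * (1 + A * ‖G₂ z‖ ^ 2))) * ‖z - x‖ ^ 2 := by
      positivity
    have h6 : (A * (‖G₁ z‖ ^ 2 / ‖z - x‖ ^ 2) + A * (‖G₂ z‖ ^ 2 / ‖z - x‖ ^ 2) -
        ‖M z‖ ^ 2 / ‖z - x‖ ^ 2 * ((1 + A * ‖G₁ z‖ ^ 2) * (1 + A * ‖G₂ z‖ ^ 2))) * ‖z - x‖ ^ 2 =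
        A * ‖G₁ z‖ ^ 2 + A * ‖G₂ z‖ ^ 2 -
          ‖M z‖ ^ 2 * ((1 + A * ‖G₁ z‖ ^ 2) * (1 + A * ‖G₂ z‖ ^ 2)) := by
      field_simp
    rw [h6] at h5
    have h7 : 0 ≤ A * ‖G₁ z‖ ^ 2 * (A * ‖G₂ z‖ ^ 2) := by positivity
    nlinarith
  have hmax : IsLocalMax (norm ∘ Q) x := by
    rw [eventually_nhdsWithin_iff] at hstrict
    filter_upwards [hstrict] with z hz
    by_cases h : z = x
    · rw [h]
    · exact (hz h).le
  have hconst := Complex.eventually_eq_of_isLocalMax_norm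
    (hQ.eventually_analyticAt.mono fun z hz => hz.differentiableAt) hmax
  obtain ⟨z, hz1, hz2⟩ := (hstrict.and (nhdsWithin_le_nhds hconst)).exists
  rw [hz2] at hz1
  exact lt_irrefl _ hz1

/-! ### The cone metric: curvature and comparison with the sphere -/

/-- The density of a conformal metric on `ℂ \ {0, 1}`, as a function of `p = |w|`, `q = |w - 1|`. -/
noncomputable def coneDensity (a b s A p q : ℝ) : ℝ :=
  p ^ (a - 1) * q ^ (b - 1) * ((1 + (p ^ s) ^ 2) ^ A * (1 + (q ^ s) ^ 2) ^ A)

lemma coneDensity_swap (a b s A p q : ℝ) : coneDensity a b s A p q = coneDensity b a s A q p := by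
  unfold coneDensity; ring

lemma coneDensity_nonneg (a b s A : ℝ) {p q : ℝ} (hp : 0 ≤ p) (hq : 0 ≤ q) :
    0 ≤ coneDensity a b s A p q := by
  unfold coneDensity; positivity

lemma rpow_le_of_one_le {t e : ℝ} (ht : 1 ≤ t) (he : e ≤ 1) : t ^ e ≤ t :=
  (Real.rpow_le_rpow_of_exponent_le ht he).trans_eq (Real.rpow_one t)

lemma rpow_neg_le_inv {t m e : ℝ} (hm : 0 < m) (hm1 : m ≤ 1) (ht : m ≤ t) (h0 : 0 ≤ e)
    (h1 : e ≤ 1) : t ^ (-e) ≤ m⁻¹ := by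
  calc t ^ (-e) ≤ m ^ (-e) := Real.rpow_le_rpow_of_nonpos hm ht (by linarith)
    _ ≤ m ^ (-1 : ℝ) := Real.rpow_le_rpow_of_exponent_ge hm hm1 (by linarith)
    _ = m⁻¹ := Real.rpow_neg_one m

/-- Near w = 0 the density is of order p^(a-1), and `s ≤ a` makes this at most p^(s-1). The last
factor, squared and multiplied by 4A, is the Laplacian of A log(1 + |w|^(2s)). -/
lemma coneDensity_le_of_le_half {a b s A p q : ℝ} (hs : 0 < s) (hA : 0 ≤ A) (hsa : s ≤ a)
    (hb : 0 < b) (hb1 : b < 1) (hs1 : s ≤ 1) (hp : 0 < p) (hp2 : p ≤ 1 / 2)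
    (hqp : q ≤ p + 1) (hpq : 1 ≤ p + q) :
    coneDensity a b s A p q ≤ 4 * (2 ^ A * 5 ^ A) / s * (s * p ^ (s - 1) / (1 + (p ^ s) ^ 2)) := by
  have hq : 1 / 2 ≤ q := by linarith
  have h1 : q ^ (b - 1) ≤ 2 := by
    have := rpow_neg_le_inv (by norm_num) (by norm_num) hq (e := 1 - b) (by linarith) (by linarith)
    rw [neg_sub] at this
    exact this.trans_eq (by norm_num)
  have h2 : p ^ s ≤ 1 := Real.rpow_le_one hp.le (by linarith) hs.le
  have h2' : 0 < p ^ s := Real.rpow_pos_of_pos hp s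
  have h3 : q ^ s ≤ 2 := (Real.rpow_le_rpow (by linarith) (by linarith) hs.le).trans
    (rpow_le_of_one_le one_le_two hs1)
  have h3' : 0 ≤ q ^ s := Real.rpow_nonneg (by linarith) s
  have h4 : (1 + (p ^ s) ^ 2) ^ A ≤ 2 ^ A := Real.rpow_le_rpow (by positivity) (by nlinarith) hA
  have h5 : (1 + (q ^ s) ^ 2) ^ A ≤ 5 ^ A := Real.rpow_le_rpow (by positivity) (by nlinarith) hA
  have h6 : p ^ (a - 1) ≤ p ^ (s - 1) :=
    Real.rpow_le_rpow_of_exponent_ge hp (by linarith) (by linarith)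
  have h7 : 0 < p ^ (s - 1) := Real.rpow_pos_of_pos hp _
  have h8 : coneDensity a b s A p q ≤ p ^ (s - 1) * 2 * (2 ^ A * 5 ^ A) := by
    unfold coneDensity
    gcongr
  refine h8.trans ?_
  have h9 : p ^ (s - 1) / 2 ≤ p ^ (s - 1) / (1 + (p ^ s) ^ 2) := by
    gcongr
    nlinarith
  calc p ^ (s - 1) * 2 * (2 ^ A * 5 ^ A) = 4 * (2 ^ A * 5 ^ A) * (p ^ (s - 1) / 2) := by ring
    _ ≤ 4 * (2 ^ A * 5 ^ A) * (p ^ (s - 1) / (1 + (p ^ s) ^ 2)) := by gcongr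
    _ = _ := by field_simp

/-- Away from 0 and 1, p and q are comparable up to a factor 3, so by `hsum` the density is of order
p^(-1-c). The right side decays like p^(-1-s), hence the condition `s ≤ c`. -/
lemma coneDensity_le_of_half_le {a b c s A p q : ℝ} (hs : 0 < s) (hA : 0 ≤ A)
    (hsc : s ≤ c) (hb : 0 < b) (hb1 : b < 1) (hc1 : c ≤ 1) (hsum : a + b + c + 4 * s * A = 1)
    (hp : 1 / 2 ≤ p) (hq : 1 / 2 ≤ q) (hqp : q ≤ p + 1) (hpq : p ≤ q + 1) :
    coneDensity a b s A p q ≤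
      30 * (5 ^ A * 13 ^ A) / s * (s * p ^ (s - 1) / (1 + (p ^ s) ^ 2)) := by
  have hp0 : 0 < p := by linarith
  have hq0 : 0 < q := by linarith
  have hs1 : s ≤ 1 := hsc.trans hc1
  set P := p ^ s with hP
  have hP0 : 0 < P := Real.rpow_pos_of_pos hp0 s
  have hP1 : 1 ≤ 2 * P := by
    have := rpow_neg_le_inv (by norm_num) (by norm_num) hp hs.le hs1
    rw [Real.rpow_neg hp0.le, ← hP] at this
    norm_num at this
    rw [inv_le_comm₀ hP0 two_pos] at this
    linarith
  have h1 : q ^ (b - 1) ≤ 3 * p ^ (b - 1) := by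
    have h := Real.rpow_le_rpow_of_nonpos (x := p / 3) (y := q) (z := b - 1) (by linarith)
      (by linarith) (by linarith)
    rw [Real.div_rpow hp0.le (by norm_num)] at h
    have h' : (3 : ℝ) ^ (-1 : ℝ) ≤ 3 ^ (b - 1) :=
      Real.rpow_le_rpow_of_exponent_le (by norm_num) (by linarith)
    rw [Real.rpow_neg_one] at h'
    refine h.trans ?_
    rw [div_le_iff₀ (by positivity)]
    have := Real.rpow_pos_of_pos hp0 (b - 1)
    nlinarith
  have h2 : q ^ s ≤ 3 * P := by
    have h := Real.rpow_le_rpow (x := q) (y := 3 * p) (z := s) (by linarith) (by linarith) hs.le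
    rw [Real.mul_rpow (by norm_num) hp0.le] at h
    have := rpow_le_of_one_le (t := 3) (e := s) (by norm_num) hs1
    exact h.trans (by gcongr)
  have h2' : 0 ≤ q ^ s := Real.rpow_nonneg (by linarith) s
  have h4 : (1 + P ^ 2) ^ A ≤ 5 ^ A * (P ^ 2) ^ A := by
    rw [← Real.mul_rpow (by norm_num) (by positivity)]
    exact Real.rpow_le_rpow (by positivity) (by nlinarith) hA
  have h5 : (1 + (q ^ s) ^ 2) ^ A ≤ 13 ^ A * (P ^ 2) ^ A := by
    rw [← Real.mul_rpow (by norm_num) (by positivity)]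
    exact Real.rpow_le_rpow (by positivity) (by nlinarith) hA
  have hPA : (P ^ 2) ^ A = p ^ (2 * s * A) := by
    rw [hP, ← Real.rpow_natCast, ← Real.rpow_mul hp0.le, ← Real.rpow_mul hp0.le]
    congr 1; push_cast; ring
  have h8 : coneDensity a b s A p q ≤
      p ^ (a - 1) * (3 * p ^ (b - 1)) * ((5 ^ A * (P ^ 2) ^ A) * (13 ^ A * (P ^ 2) ^ A)) := by
    unfold coneDensity
    gcongr
  have h9 : p ^ (a - 1) * (3 * p ^ (b - 1)) * ((5 ^ A * (P ^ 2) ^ A) * (13 ^ A * (P ^ 2) ^ A)) =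
      3 * (5 ^ A * 13 ^ A) * p ^ (-1 - c) := by
    have : p ^ (-1 - c) = p ^ (a - 1) * p ^ (b - 1) * p ^ (2 * s * A) * p ^ (2 * s * A) := by
      rw [← Real.rpow_add hp0, ← Real.rpow_add hp0, ← Real.rpow_add hp0]
      congr 1; linarith
    rw [hPA, this]; ring
  have h10 : p ^ (-1 - c) ≤ 2 * p ^ (-1 - s) := by
    have := rpow_neg_le_inv (by norm_num) (by norm_num) hp (e := c - s) (by linarith) (by linarith)
    have e : p ^ (-1 - c) = p ^ (-(c - s)) * p ^ (-1 - s) := by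
      rw [← Real.rpow_add hp0]; congr 1; ring
    rw [e]
    norm_num at this
    gcongr
    simpa using this
  have h11 : p ^ (-1 - s) / 5 ≤ p ^ (s - 1) / (1 + P ^ 2) := by
    have e : p ^ (s - 1) = p ^ (-1 - s) * P ^ 2 := by
      rw [hP, ← Real.rpow_natCast, ← Real.rpow_mul hp0.le, ← Real.rpow_add hp0]
      congr 1; push_cast; ring
    rw [e, div_le_div_iff₀ (by norm_num) (by positivity)]
    have := Real.rpow_pos_of_pos hp0 (-1 - s)
    have hP2 : 1 + P ^ 2 ≤ P ^ 2 * 5 := by nlinarith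
    rw [mul_assoc]
    gcongr
  calc coneDensity a b s A p q ≤ 3 * (5 ^ A * 13 ^ A) * p ^ (-1 - c) := h8.trans_eq h9
    _ ≤ 3 * (5 ^ A * 13 ^ A) * (2 * p ^ (-1 - s)) := by gcongr
    _ = 30 * (5 ^ A * 13 ^ A) * (p ^ (-1 - s) / 5) := by ring
    _ ≤ 30 * (5 ^ A * 13 ^ A) * (p ^ (s - 1) / (1 + P ^ 2)) := by gcongr
    _ = _ := by field_simp

/-- The curvature of `coneDensity` is bounded above by a negative constant. -/
lemma exists_coneDensity_sq_le {a b c s A : ℝ} (hs : 0 < s) (hA : 1 ≤ A) (hsa : s ≤ a)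
    (hsb : s ≤ b) (hsc : s ≤ c) (hsum : a + b + c + 4 * s * A = 1) :
    ∃ C : ℝ, 0 < C ∧ ∀ p q : ℝ, 0 < p → 0 < q → q ≤ p + 1 → p ≤ q + 1 → 1 ≤ p + q →
      coneDensity a b s A p q ^ 2 ≤ C * (A * (s * p ^ (s - 1) / (1 + (p ^ s) ^ 2)) ^ 2 +
        A * (s * q ^ (s - 1) / (1 + (q ^ s) ^ 2)) ^ 2) := by
  have hsA : 0 < s * A := by positivity
  set C₁ : ℝ := 4 * (2 ^ A * 5 ^ A) / s
  set C₂ : ℝ := 30 * (5 ^ A * 13 ^ A) / s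
  have hC₁ : 0 < C₁ := by positivity
  have hC₂ : 0 < C₂ := by positivity
  refine ⟨C₁ ^ 2 + C₂ ^ 2, by positivity, fun p q hp hq hqp hpq h1 => ?_⟩
  have h0 := coneDensity_nonneg a b s A hp.le hq.le
  set X := s * p ^ (s - 1) / (1 + (p ^ s) ^ 2)
  set Y := s * q ^ (s - 1) / (1 + (q ^ s) ^ 2)
  have hX : X ^ 2 ≤ A * X ^ 2 := le_mul_of_one_le_left (sq_nonneg _) hA
  have hY : Y ^ 2 ≤ A * Y ^ 2 := le_mul_of_one_le_left (sq_nonneg _) hA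
  have hX0 := sq_nonneg X
  have hY0 := sq_nonneg Y
  have hfin : ∀ C Z : ℝ, C ^ 2 ≤ C₁ ^ 2 + C₂ ^ 2 → Z ^ 2 ≤ A * X ^ 2 + A * Y ^ 2 →
      coneDensity a b s A p q ≤ C * Z →
      coneDensity a b s A p q ^ 2 ≤ (C₁ ^ 2 + C₂ ^ 2) * (A * X ^ 2 + A * Y ^ 2) := by
    intro C Z hC hZ h
    calc coneDensity a b s A p q ^ 2 ≤ (C * Z) ^ 2 := pow_le_pow_left₀ h0 h 2
      _ = C ^ 2 * Z ^ 2 := mul_pow _ _ _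
      _ ≤ _ := mul_le_mul hC hZ (sq_nonneg _) (by positivity)
  -- Three regions: near 0, near 1 (by the symmetry exchanging p and q), and the rest, including ∞.
  rcases le_or_gt p (1 / 2) with hp2 | hp2
  · exact hfin C₁ X (by nlinarith) (by linarith) (coneDensity_le_of_le_half hs (by linarith) hsa
      (by linarith) (by linarith) (by linarith) hp hp2 hqp h1)
  rcases le_or_gt q (1 / 2) with hq2 | hq2
  · refine hfin C₁ Y (by nlinarith) (by linarith) ?_
    rw [coneDensity_swap]
    exact coneDensity_le_of_le_half hs (by linarith) hsb (by linarith) (by linarith) (by linarith)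
      hq hq2 hpq (by linarith)
  · exact hfin C₂ X (by nlinarith) (by linarith) (coneDensity_le_of_half_le hs (by linarith) hsc
      (by linarith) (by linarith) (by linarith) hsum hp2.le hq2.le hqp hpq)

lemma inv_le_coneDensity_of_le_half {a b s A p q : ℝ} (hA : 0 ≤ A) (ha1 : a < 1) (hb : 0 < b)
    (hb1 : b < 1) (hp : 0 < p) (hp2 : p ≤ 1 / 2) (hqp : q ≤ p + 1) (hpq : 1 ≤ p + q) :
    (1 : ℝ) ≤ 2 * coneDensity a b s A p q := by
  have hq0 : 0 < q := by linarith
  have h1 : (1 : ℝ) / 2 ≤ q ^ (b - 1) := by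
    calc (1 : ℝ) / 2 = 2 ^ (-1 : ℝ) := by rw [Real.rpow_neg_one]; norm_num
      _ ≤ 2 ^ (b - 1) := Real.rpow_le_rpow_of_exponent_le (by norm_num) (by linarith)
      _ ≤ q ^ (b - 1) := Real.rpow_le_rpow_of_nonpos hq0 (by linarith) (by linarith)
  have h2 : 1 ≤ p ^ (a - 1) := Real.one_le_rpow_of_pos_of_le_one_of_nonpos hp (by linarith)
    (by linarith)
  have h3 : ∀ t : ℝ, 1 ≤ (1 + t ^ 2) ^ A := fun t => Real.one_le_rpow (by nlinarith) hA
  have h4 : 1 * (1 / 2) * (1 * 1) ≤ coneDensity a b s A p q := by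
    unfold coneDensity
    gcongr
    · exact h3 _
    · exact h3 _
  linarith

/-- Here the density is at least of order p^(-1-c), which dominates p^(-2) because `c ≤ 1`. -/
lemma inv_le_coneDensity_of_half_le {a b c s A p q : ℝ} (hs : 0 < s) (hs1 : s ≤ 1) (hA : 0 ≤ A)
    (hb : 0 < b) (hb1 : b < 1) (hc0 : 0 < c) (hc1 : c ≤ 1) (hsum : a + b + c + 4 * s * A = 1)
    (hp : 1 / 2 ≤ p) (hq : 1 / 2 ≤ q) (hqp : q ≤ p + 1) (hpq : p ≤ q + 1) :
    (1 + p ^ 2)⁻¹ ≤ 6 * 9 ^ A * coneDensity a b s A p q := by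
  have hp0 : 0 < p := by linarith
  have hq0 : 0 < q := by linarith
  set P := p ^ s with hP
  have hP0 : 0 < P := Real.rpow_pos_of_pos hp0 s
  have h1 : p ^ (b - 1) / 3 ≤ q ^ (b - 1) := by
    have h := Real.rpow_le_rpow_of_nonpos (x := q) (y := 3 * p) (z := b - 1) hq0
      (by linarith) (by linarith)
    rw [Real.mul_rpow (by norm_num) hp0.le] at h
    have h' : (3 : ℝ) ^ (-1 : ℝ) ≤ 3 ^ (b - 1) :=
      Real.rpow_le_rpow_of_exponent_le (by norm_num) (by linarith)
    rw [Real.rpow_neg_one] at h'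
    have := Real.rpow_pos_of_pos hp0 (b - 1)
    nlinarith
  have h2 : P / 3 ≤ q ^ s := by
    have h := Real.rpow_le_rpow (x := p / 3) (y := q) (z := s) (by linarith) (by linarith) hs.le
    rw [Real.div_rpow hp0.le (by norm_num)] at h
    have := rpow_le_of_one_le (t := 3) (e := s) (by norm_num) hs1
    refine le_trans ?_ h
    gcongr
  have h4 : (P ^ 2) ^ A ≤ (1 + P ^ 2) ^ A :=
    Real.rpow_le_rpow (by positivity) (by nlinarith) hA
  have h5 : (P ^ 2) ^ A / 9 ^ A ≤ (1 + (q ^ s) ^ 2) ^ A := by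
    rw [← Real.div_rpow (by positivity) (by norm_num)]
    refine Real.rpow_le_rpow (by positivity) ?_ hA
    have : (P / 3) ^ 2 ≤ (q ^ s) ^ 2 := pow_le_pow_left₀ (by positivity) h2 2
    linarith
  have hPA : (P ^ 2) ^ A = p ^ (2 * s * A) := by
    rw [hP, ← Real.rpow_natCast, ← Real.rpow_mul hp0.le, ← Real.rpow_mul hp0.le]
    congr 1; push_cast; ring
  have h8 : p ^ (a - 1) * (p ^ (b - 1) / 3) * ((P ^ 2) ^ A * ((P ^ 2) ^ A / 9 ^ A)) ≤
      coneDensity a b s A p q := by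
    unfold coneDensity
    gcongr
  have h9 : p ^ (a - 1) * (p ^ (b - 1) / 3) * ((P ^ 2) ^ A * ((P ^ 2) ^ A / 9 ^ A)) =
      p ^ (-1 - c) / (3 * 9 ^ A) := by
    have : p ^ (-1 - c) = p ^ (a - 1) * p ^ (b - 1) * p ^ (2 * s * A) * p ^ (2 * s * A) := by
      rw [← Real.rpow_add hp0, ← Real.rpow_add hp0, ← Real.rpow_add hp0]
      congr 1; linarith
    rw [hPA, this]; field_simp
  have h10 : (1 + p ^ 2)⁻¹ ≤ 2 * p ^ (-1 - c) := by
    have := rpow_neg_le_inv (by norm_num) (by norm_num) hp (e := 1 - c) (by linarith) (by linarith)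
    calc (1 + p ^ 2)⁻¹ ≤ (p ^ 2)⁻¹ := by gcongr; linarith
      _ = p ^ (-(1 - c)) * p ^ (-1 - c) := by
        rw [← Real.rpow_add hp0, ← Real.rpow_natCast, ← Real.rpow_neg hp0.le]
        congr 1; push_cast; ring
      _ ≤ 2 * p ^ (-1 - c) := by gcongr; exact this.trans_eq (by norm_num)
  rw [h9] at h8
  calc (1 + p ^ 2)⁻¹ ≤ 2 * p ^ (-1 - c) := h10
    _ = 6 * 9 ^ A * (p ^ (-1 - c) / (3 * 9 ^ A)) := by field_simp; norm_num
    _ ≤ _ := by gcongr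

/-- `coneDensity` dominates the density of the spherical metric. -/
lemma exists_inv_le_coneDensity {a b c s A : ℝ} (hs : 0 < s) (hA : 1 ≤ A) (ha : 0 < a)
    (hb : 0 < b) (hc : 0 < c) (hsum : a + b + c + 4 * s * A = 1) :
    ∃ C : ℝ, 0 < C ∧ ∀ p q : ℝ, 0 < p → 0 < q → q ≤ p + 1 → p ≤ q + 1 → 1 ≤ p + q →
      (1 + p ^ 2)⁻¹ ≤ C * coneDensity a b s A p q := by
  have hsA : s ≤ s * A := le_mul_of_one_le_right hs.le hA
  refine ⟨2 + 6 * 9 ^ A, by positivity, fun p q hp hq hqp hpq h1 => ?_⟩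
  have h0 := coneDensity_nonneg a b s A hp.le hq.le
  have h9 : (0 : ℝ) ≤ 6 * 9 ^ A := by positivity
  have hle : (1 + p ^ 2)⁻¹ ≤ 1 := inv_le_one_of_one_le₀ (by nlinarith)
  have h9' := mul_nonneg h9 h0
  rw [add_mul]
  rcases le_or_gt p (1 / 2) with hp2 | hp2
  · have := inv_le_coneDensity_of_le_half (s := s) (A := A) (a := a) (b := b) (by linarith)
      (by linarith) hb (by linarith) hp hp2 hqp h1
    linarith
  rcases le_or_gt q (1 / 2) with hq2 | hq2
  · have := inv_le_coneDensity_of_le_half (s := s) (A := A) (a := b) (b := a) (by linarith)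
      (by linarith) ha (by linarith) hq hq2 hpq (by linarith)
    rw [← coneDensity_swap] at this
    linarith
  · have := inv_le_coneDensity_of_half_le hs (by linarith) (by linarith : 0 ≤ A) hb
      (by linarith) hc (by linarith) hsum hp2.le hq2.le hqp hpq
    linarith

/-! ### Pulling the metric back by a ramified function -/

/-- If `F` has a zero of order at least `k > 1 / a`, then `|F| ^ (a - 1) |F'|` tends to zero. -/
lemma AnalyticAt.tendsto_rpow_mul_deriv {F : ℂ → ℂ} {x : ℂ} (hF : AnalyticAt ℂ F x)
    (hx : F x = 0) {k : ℕ} (hk : (k : ℕ∞) ≤ analyticOrderAt F x) {a : ℝ} (ha : 0 ≤ a) (ha1 : a < 1)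
    (hka : 1 < k * a) :
    Tendsto (fun z => ‖F z‖ ^ (a - 1) * ‖deriv F z‖) (𝓝 x) (𝓝 0) := by
  have ha0 : a - 1 ≠ 0 := by linarith
  by_cases htop : analyticOrderAt F x = ⊤
  · rw [analyticOrderAt_eq_top] at htop
    refine tendsto_const_nhds.congr' ?_
    filter_upwards [htop] with z hz
    rw [hz, norm_zero, Real.zero_rpow ha0, zero_mul]
  obtain ⟨m, hm⟩ := ENat.ne_top_iff_exists.1 htop
  rw [← hm, Nat.cast_le] at hk
  obtain ⟨g, hg, hgx, hFg⟩ := (hF.analyticOrderAt_eq_natCast).1 hm.symm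
  have hm0 : m ≠ 0 := by
    rintro rfl
    have : F x = g x := by simpa using hFg.self_of_nhds
    exact hgx (this ▸ hx)
  have hma : 0 < m * a - 1 := by
    have : (k : ℝ) ≤ m := by exact_mod_cast hk
    nlinarith
  -- With F = (z - x)^m g, the power of |z - x| is m(a-1) + (m-1) = ma - 1 > 0.
  have hlim : Tendsto (fun z => ‖z - x‖ ^ (m * a - 1) * (‖g z‖ ^ (a - 1) *
      ‖m * g z + (z - x) * deriv g z‖)) (𝓝 x) (𝓝 0) := by
    have h1 : ContinuousAt (fun z => ‖z - x‖ ^ (m * a - 1)) x :=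
      (continuousAt_id.sub continuousAt_const).norm.rpow_const (Or.inr hma.le)
    have h2 : ContinuousAt (fun z => ‖g z‖ ^ (a - 1) * ‖m * g z + (z - x) * deriv g z‖) x := by
      refine (hg.continuousAt.norm.rpow_const (Or.inl (norm_ne_zero_iff.2 hgx))).mul ?_
      exact ((continuousAt_const.mul hg.continuousAt).add
        ((continuousAt_id.sub continuousAt_const).mul hg.deriv.continuousAt)).norm
    have h3 : ContinuousAt (fun z => ‖z - x‖ ^ (m * a - 1) * (‖g z‖ ^ (a - 1) *
      ‖m * g z + (z - x) * deriv g z‖)) x := h1.mul h2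
    simpa [Real.zero_rpow hma.ne'] using h3.tendsto
  refine hlim.congr' ?_
  filter_upwards [hFg.eventually_nhds, hg.eventually_analyticAt] with z hz hgz
  by_cases hzx : z = x
  · rw [hzx, hx]
    simp [Real.zero_rpow hma.ne', Real.zero_rpow ha0]
  have hpos : 0 < ‖z - x‖ := norm_pos_iff.2 (sub_ne_zero.2 hzx)
  have hd : deriv F z = (z - x) ^ (m - 1) * (m * g z + (z - x) * deriv g z) := by
    rw [EventuallyEq.deriv_eq hz]
    have h3 := ((((hasDerivAt_id z).sub_const x).pow m).mul
      hgz.differentiableAt.hasDerivAt).deriv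
    refine Eq.trans h3 ?_
    obtain ⟨n, rfl⟩ := Nat.exists_eq_succ_of_ne_zero hm0
    simp only [id, Nat.succ_eq_add_one, Nat.add_sub_cancel, Pi.pow_apply]
    push_cast
    ring
  rw [hd, hz.self_of_nhds, smul_eq_mul, norm_mul, norm_mul, norm_pow, norm_pow,
    Real.mul_rpow (by positivity) (by positivity), ← Real.rpow_natCast, ← Real.rpow_natCast,
    ← Real.rpow_mul hpos.le]
  have : ‖z - x‖ ^ (m * a - 1) = ‖z - x‖ ^ (m * (a - 1)) * ‖z - x‖ ^ ((m - 1 : ℕ) : ℝ) := by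
    rw [← Real.rpow_add hpos, Nat.cast_sub (Nat.one_le_iff_ne_zero.2 hm0)]
    congr 1
    push_cast; ring
  rw [this]
  ring

/-- At `z`, the function `f` is holomorphic with value outside `{0, 1}`, or takes one of the values
`0`, `1`, `∞` with multiplicity at least `k`, `l`, `h` respectively. In the last case `f z = 0`. -/
def IsRamifiedAt (h k l : ℕ) (f : ℂ → ℂ) (z : ℂ) : Prop :=
  (AnalyticAt ℂ f z ∧ f z ≠ 0 ∧ f z ≠ 1) ∨
  (AnalyticAt ℂ f z ∧ f z = 0 ∧ (k : ℕ∞) ≤ analyticOrderAt f z) ∨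
  (AnalyticAt ℂ f z ∧ f z = 1 ∧ (l : ℕ∞) ≤ analyticOrderAt (fun w => f w - 1) z) ∨
  (AnalyticAt ℂ f⁻¹ z ∧ f z = 0 ∧ (h : ℕ∞) ≤ analyticOrderAt f⁻¹ z ∧ meromorphicOrderAt f z < 0)

/-- The density of the pullback under `f` of the metric with density `coneDensity`. -/
noncomputable def pullbackDensity (a b s A : ℝ) (f : ℂ → ℂ) (z : ℂ) : ℝ :=
  coneDensity a b s A ‖f z‖ ‖f z - 1‖ * ‖deriv f z‖

lemma pullbackDensity_nonneg (a b s A : ℝ) (f : ℂ → ℂ) (z : ℂ) :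
    0 ≤ pullbackDensity a b s A f z :=
  mul_nonneg (coneDensity_nonneg _ _ _ _ (norm_nonneg _) (norm_nonneg _)) (norm_nonneg _)

/-- This rests on the convention 0^(a-1) = 0. It also covers poles in normal form, where `f z = 0`,
and agrees with the limit of the density at ramified points. -/
lemma pullbackDensity_eq_zero_left {a b s A : ℝ} {f : ℂ → ℂ} {z : ℂ} (ha : a ≠ 1) (h : f z = 0) :
    pullbackDensity a b s A f z = 0 := by
  simp [pullbackDensity, coneDensity, h, Real.zero_rpow (sub_ne_zero.2 ha)]

lemma pullbackDensity_eq_zero_right {a b s A : ℝ} {f : ℂ → ℂ} {z : ℂ} (hb : b ≠ 1) (h : f z = 1) :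
    pullbackDensity a b s A f z = 0 := by
  simp [pullbackDensity, coneDensity, h, Real.zero_rpow (sub_ne_zero.2 hb)]

lemma continuousAt_one_add_rpow_sq {s A : ℝ} (hs : 0 ≤ s) {g : ℂ → ℂ} {x : ℂ}
    (hg : ContinuousAt g x) : ContinuousAt (fun z => (1 + (‖g z‖ ^ s) ^ 2) ^ A) x := by
  have h : ContinuousAt (fun z => 1 + (‖g z‖ ^ s) ^ 2) x :=
    continuousAt_const.add ((hg.norm.rpow_const (Or.inr hs)).pow 2)
  exact h.rpow_const (Or.inl (by positivity))

/-- The metric in the chart 1/w at ∞: `hsum` turns the exponent there into c - 1, and the remaining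
factor is continuous at w = 0. -/
lemma coneDensity_inv {a b c s A : ℝ} (hsum : a + b + c + 4 * s * A = 1) {w : ℂ} (hw : w ≠ 0) :
    coneDensity a b s A ‖w⁻¹‖ ‖w⁻¹ - 1‖ * (‖w‖ ^ 2)⁻¹ =
      ‖w‖ ^ (c - 1) * (‖1 - w‖ ^ (b - 1) * ((1 + (‖w‖ ^ s) ^ 2) ^ A *
        ((‖w‖ ^ s) ^ 2 + (‖1 - w‖ ^ s) ^ 2) ^ A)) := by
  have hp : 0 < ‖w‖ := norm_pos_iff.2 hw
  have h1 : w⁻¹ - 1 = (1 - w) / w := by field_simp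
  rw [h1, norm_inv, norm_div]
  set p := ‖w‖
  set q := ‖1 - w‖ with hq
  have hq0 : 0 ≤ q := norm_nonneg _
  unfold coneDensity
  have hP : 0 < p ^ s := Real.rpow_pos_of_pos hp s
  have e1 : 1 + (p⁻¹ ^ s) ^ 2 = (1 + (p ^ s) ^ 2) / (p ^ s) ^ 2 := by
    rw [Real.inv_rpow hp.le]; field_simp; ring
  have e2 : 1 + ((q / p) ^ s) ^ 2 = ((p ^ s) ^ 2 + (q ^ s) ^ 2) / (p ^ s) ^ 2 := by
    rw [Real.div_rpow hq0 hp.le]; field_simp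
  rw [e1, e2, Real.div_rpow (by positivity) (by positivity),
    Real.div_rpow (by positivity) (by positivity),
    Real.div_rpow (by positivity) (by positivity), Real.inv_rpow hp.le]
  have hPA : ((p ^ s) ^ 2) ^ A = p ^ (2 * s * A) := by
    rw [← Real.rpow_natCast, ← Real.rpow_mul hp.le, ← Real.rpow_mul hp.le]
    congr 1; push_cast; ring
  have e3 : p ^ (c - 1) * (p ^ (a - 1) * p ^ (b - 1) * p ^ (2 * s * A) * p ^ (2 * s * A)
      * p ^ 2) = 1 := by
    rw [← Real.rpow_natCast p 2, ← Real.rpow_add hp, ← Real.rpow_add hp, ← Real.rpow_add hp,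
      ← Real.rpow_add hp, ← Real.rpow_add hp]
    convert Real.rpow_zero p using 2
    push_cast; linarith
  rw [hPA]
  have n1 := (Real.rpow_pos_of_pos hp (a - 1)).ne'
  have n2 := (Real.rpow_pos_of_pos hp (b - 1)).ne'
  have n3 := (Real.rpow_pos_of_pos hp (2 * s * A)).ne'
  have e4 : p ^ (c - 1) = (p ^ (a - 1) * p ^ (b - 1) * p ^ (2 * s * A) * p ^ (2 * s * A)
      * p ^ 2)⁻¹ := eq_inv_of_mul_eq_one_left e3
  rw [e4]
  field_simp

section
variable {h k l : ℕ} {a b c s A : ℝ} {f : ℂ → ℂ} {x : ℂ}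

/-- Over 0, 1, ∞ the density is |G|^(e-1)|G'| times a continuous factor, with G = f, f - 1, 1/f and
e = a, b, c. It tends to 0, which is its conventional value there. -/
lemma IsRamifiedAt.continuousAt_pullbackDensity (hf : IsRamifiedAt h k l f x) (hs : 0 < s)
    (hA : 1 ≤ A) (ha : 0 < a) (hb : 0 < b) (hc : 0 < c) (hsum : a + b + c + 4 * s * A = 1)
    (hka : 1 < k * a) (hlb : 1 < l * b) (hhc : 1 < h * c) :
    ContinuousAt (pullbackDensity a b s A f) x := by
  have hsA : 0 < s * A := by positivity
  rcases hf with ⟨hf, h0, h1⟩ | ⟨hf, h0, hord⟩ | ⟨hf, h1, hord⟩ | ⟨hF, h0, hord, hneg⟩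
  · have hc' := hf.continuousAt
    refine ContinuousAt.mul (ContinuousAt.mul (ContinuousAt.mul ?_ ?_) (ContinuousAt.mul ?_ ?_))
      hf.deriv.continuousAt.norm
    · exact hc'.norm.rpow_const (Or.inl (norm_ne_zero_iff.2 h0))
    · exact (hc'.sub continuousAt_const).norm.rpow_const
        (Or.inl (norm_ne_zero_iff.2 (sub_ne_zero.2 h1)))
    · exact continuousAt_one_add_rpow_sq hs.le hc'
    · exact continuousAt_one_add_rpow_sq hs.le (hc'.sub continuousAt_const)
  · have hc' := hf.continuousAt
    rw [ContinuousAt, pullbackDensity_eq_zero_left (by linarith) h0]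
    have t1 := hf.tendsto_rpow_mul_deriv h0 hord ha.le (by linarith) hka
    have t2 : ContinuousAt (fun z => ‖f z - 1‖ ^ (b - 1) * ((1 + (‖f z‖ ^ s) ^ 2) ^ A *
        (1 + (‖f z - 1‖ ^ s) ^ 2) ^ A)) x := by
      refine ContinuousAt.mul ?_ (ContinuousAt.mul ?_ ?_)
      · exact (hc'.sub continuousAt_const).norm.rpow_const (Or.inl (by simp [h0]))
      · exact continuousAt_one_add_rpow_sq hs.le hc'
      · exact continuousAt_one_add_rpow_sq hs.le (hc'.sub continuousAt_const)
    have t3 := t1.mul t2.tendsto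
    rw [zero_mul] at t3
    refine t3.congr fun z => ?_
    unfold pullbackDensity coneDensity
    ring
  · have hc' := hf.continuousAt
    rw [ContinuousAt, pullbackDensity_eq_zero_right (by linarith) h1]
    have t1 := (hf.sub analyticAt_const).tendsto_rpow_mul_deriv (by simp [h1]) hord hb.le
      (by linarith) hlb
    have t2 : ContinuousAt (fun z => ‖f z‖ ^ (a - 1) * ((1 + (‖f z‖ ^ s) ^ 2) ^ A *
        (1 + (‖f z - 1‖ ^ s) ^ 2) ^ A)) x := by
      refine ContinuousAt.mul ?_ (ContinuousAt.mul ?_ ?_)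
      · exact hc'.norm.rpow_const (Or.inl (by simp [h1]))
      · exact continuousAt_one_add_rpow_sq hs.le hc'
      · exact continuousAt_one_add_rpow_sq hs.le (hc'.sub continuousAt_const)
    have t3 := t1.mul t2.tendsto
    rw [zero_mul] at t3
    refine t3.congr fun z => ?_
    have hd : deriv (f - fun _ => (1 : ℂ)) z = deriv f z := deriv_sub_const 1
    rw [hd]
    unfold pullbackDensity coneDensity
    simp only [Pi.sub_apply]
    ring
  · set F := f⁻¹ with hFdef
    have hfF : f = F⁻¹ := (inv_inv f).symm
    have hc' := hF.continuousAt
    have hFx : F x = 0 := by simp [hFdef, h0]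
    rw [ContinuousAt, pullbackDensity_eq_zero_left (by linarith) h0]
    have t1 := hF.tendsto_rpow_mul_deriv hFx hord hc.le (by linarith) hhc
    have t2 : ContinuousAt (fun z => ‖1 - F z‖ ^ (b - 1) * ((1 + (‖F z‖ ^ s) ^ 2) ^ A *
        ((‖F z‖ ^ s) ^ 2 + (‖1 - F z‖ ^ s) ^ 2) ^ A)) x := by
      refine ContinuousAt.mul ?_ (ContinuousAt.mul ?_ ?_)
      · exact (continuousAt_const.sub hc').norm.rpow_const (Or.inl (by simp [hFx]))
      · exact continuousAt_one_add_rpow_sq hs.le hc'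
      · exact (((hc'.norm.rpow_const (Or.inr hs.le)).pow 2).add
          (((continuousAt_const.sub hc').norm.rpow_const (Or.inr hs.le)).pow 2)).rpow_const
          (Or.inl (by simp [hFx, Real.zero_rpow hs.ne']))
    have t3 := t1.mul t2.tendsto
    rw [zero_mul] at t3
    refine t3.congr' ?_
    filter_upwards [hF.eventually_analyticAt] with z hz
    by_cases hFz : F z = 0
    · have hfz : f z = 0 := by simpa [hFdef] using hFz
      rw [pullbackDensity_eq_zero_left (by linarith) hfz, hFz, norm_zero,
        Real.zero_rpow (by linarith)]
      ring
    · have hd : deriv f z = -deriv F z / F z ^ 2 := by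
        rw [hfF]
        exact (hz.differentiableAt.hasDerivAt.inv hFz).deriv
      have hfz : f z = (F z)⁻¹ := by simp [hFdef]
      have := coneDensity_inv hsum hFz
      unfold pullbackDensity
      rw [hd, hfz, norm_div, norm_neg, norm_pow]
      calc _ = ‖F z‖ ^ (c - 1) * (‖1 - F z‖ ^ (b - 1) * ((1 + (‖F z‖ ^ s) ^ 2) ^ A *
        ((‖F z‖ ^ s) ^ 2 + (‖1 - F z‖ ^ s) ^ 2) ^ A)) * ‖deriv F z‖ := by ring
        _ = _ := by rw [← this]; ring

/-! ### The Ahlfors–Schwarz lemma -/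

/-- Ahlfors' estimate at an interior maximum. -/
lemma AnalyticAt.pullbackDensity_le_of_isLocalMax (hf : AnalyticAt ℂ f x) (h0 : f x ≠ 0)
    (h1 : f x ≠ 1) (hd : deriv f x ≠ 0) (hs : 0 < s) (hA : 1 ≤ A) {C R : ℝ} (hC : 0 ≤ C)
    (hcurv : ∀ p q : ℝ, 0 < p → 0 < q → q ≤ p + 1 → p ≤ q + 1 → 1 ≤ p + q →
      coneDensity a b s A p q ^ 2 ≤ C * (A * (s * p ^ (s - 1) / (1 + (p ^ s) ^ 2)) ^ 2 +
        A * (s * q ^ (s - 1) / (1 + (q ^ s) ^ 2)) ^ 2))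
    (hx : ‖x‖ < R)
    (hmax : IsLocalMax (fun z => pullbackDensity a b s A f z * (R ^ 2 - ‖z‖ ^ 2)) x) :
    (pullbackDensity a b s A f x * (R ^ 2 - ‖x‖ ^ 2)) ^ 2 ≤ C * R ^ 2 := by
  have hpos : 0 < R ^ 2 - ‖x‖ ^ 2 := by nlinarith [norm_nonneg x]
  have hf1 : AnalyticAt ℂ (fun z => f z - 1) x := hf.sub analyticAt_const
  have hf1x : f x - 1 ≠ 0 := sub_ne_zero.2 h1
  have hd1 : deriv (fun z => f z - 1) x = deriv f x := deriv_sub_const 1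
  obtain ⟨g₁, hg₁, ng₁, dg₁⟩ := hf.exists_norm_eq_rpow h0 s
  obtain ⟨g₂, hg₂, ng₂, dg₂⟩ := hf1.exists_norm_eq_rpow hf1x s
  obtain ⟨P₁, hP₁, nP₁, -⟩ := hf.exists_norm_eq_rpow h0 (a - 1)
  obtain ⟨P₂, hP₂, nP₂, -⟩ := hf1.exists_norm_eq_rpow hf1x (b - 1)
  obtain ⟨Q₁, G₁, hQ₁, hQ₁x, hG₁, hG₁x, dG₁, eQ₁, leQ₁⟩ := hg₁.exists_one_add_norm_sq_rpow hA
  obtain ⟨Q₂, G₂, hQ₂, hQ₂x, hG₂, hG₂x, dG₂, eQ₂, leQ₂⟩ := hg₂.exists_one_add_norm_sq_rpow hA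
  obtain ⟨Q₃, M, hQ₃, hQ₃x, hM, hMx, dM, eM⟩ := exists_sq_sub_norm_sq hx
  have hV : ∀ z, pullbackDensity a b s A f z * (R ^ 2 - ‖z‖ ^ 2) =
      ‖P₁ z‖ * ‖P₂ z‖ * ‖deriv f z‖ * ((1 + ‖g₁ z‖ ^ 2) ^ A * (1 + ‖g₂ z‖ ^ 2) ^ A *
        (R ^ 2 - ‖z‖ ^ 2)) := by
    intro z
    rw [nP₁, nP₂, ng₁, ng₂]
    unfold pullbackDensity coneDensity
    ring
  -- All analytic factors go into Q. What remains compares the curvature terms G₁, G₂ of the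
  -- pullback with the hyperbolic term M.
  have key := norm_deriv_sq_le_of_isLocalMax (A := A)
    (Q := fun z => P₁ z * P₂ z * deriv f z * (Q₁ z * Q₂ z * Q₃ z))
    (by linarith) hmax ?_ ?_ ?_ hG₁ hG₁x hG₂ hG₂x hM hMx ?_
  · have hcv := hcurv ‖f x‖ ‖f x - 1‖ (norm_pos_iff.2 h0) (norm_pos_iff.2 hf1x)
      ((norm_sub_le _ _).trans_eq (by simp))
      (by simpa using norm_add_le (f x - 1) 1)
      (by simpa using norm_sub_le (f x) (f x - 1))
    rw [dG₁, dG₂, dM, dg₁, dg₂, hd1, ng₁, ng₂, abs_of_pos hs] at key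
    have hRR : (R / (R ^ 2 - ‖x‖ ^ 2)) ^ 2 * (R ^ 2 - ‖x‖ ^ 2) ^ 2 = R ^ 2 := by field_simp
    calc (pullbackDensity a b s A f x * (R ^ 2 - ‖x‖ ^ 2)) ^ 2 =
        coneDensity a b s A ‖f x‖ ‖f x - 1‖ ^ 2 * ‖deriv f x‖ ^ 2 * (R ^ 2 - ‖x‖ ^ 2) ^ 2 := by
          unfold pullbackDensity; ring
      _ ≤ C * (A * (s * ‖f x‖ ^ (s - 1) / (1 + (‖f x‖ ^ s) ^ 2)) ^ 2 +
        A * (s * ‖f x - 1‖ ^ (s - 1) / (1 + (‖f x - 1‖ ^ s) ^ 2)) ^ 2) * ‖deriv f x‖ ^ 2 *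
          (R ^ 2 - ‖x‖ ^ 2) ^ 2 := by gcongr
      _ = C * (A * (s * ‖f x‖ ^ (s - 1) * ‖deriv f x‖ / (1 + (‖f x‖ ^ s) ^ 2)) ^ 2 +
        A * (s * ‖f x - 1‖ ^ (s - 1) * ‖deriv f x‖ / (1 + (‖f x - 1‖ ^ s) ^ 2)) ^ 2) *
          (R ^ 2 - ‖x‖ ^ 2) ^ 2 := by ring
      _ ≤ C * (R / (R ^ 2 - ‖x‖ ^ 2)) ^ 2 * (R ^ 2 - ‖x‖ ^ 2) ^ 2 := by gcongr
      _ = C * R ^ 2 := by rw [mul_assoc, hRR]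
  · have := eM.self_of_nhds
    rw [hMx, norm_zero] at this
    change pullbackDensity a b s A f x * (R ^ 2 - ‖x‖ ^ 2) = _
    rw [hV x, eQ₁, eQ₂, this]
    simp only [norm_mul]
    ring
  · exact ((hP₁.mul hP₂).mul hf.deriv).mul ((hQ₁.mul hQ₂).mul hQ₃)
  · have n1 : P₁ x ≠ 0 := by
      rw [← norm_ne_zero_iff, nP₁]
      exact (Real.rpow_pos_of_pos (norm_pos_iff.2 h0) _).ne'
    have n2 : P₂ x ≠ 0 := by
      rw [← norm_ne_zero_iff, nP₂]
      exact (Real.rpow_pos_of_pos (norm_pos_iff.2 hf1x) _).ne'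
    simp [n1, n2, hd, hQ₁x, hQ₂x, hQ₃x]
  · have hball : ∀ᶠ z in 𝓝 x, ‖z‖ < R := continuous_norm.continuousAt.eventually_lt_const hx
    filter_upwards [leQ₁, leQ₂, eM, hball] with z l1 l2 e hz
    have hz' : 0 ≤ R ^ 2 - ‖z‖ ^ 2 := by nlinarith [norm_nonneg z]
    rw [hV]
    simp only [norm_mul]
    calc _ = ‖P₁ z‖ * ‖P₂ z‖ * ‖deriv f z‖ * ((‖Q₁ z‖ * (1 + A * ‖G₁ z‖ ^ 2)) *
          (‖Q₂ z‖ * (1 + A * ‖G₂ z‖ ^ 2)) * (‖Q₃ z‖ * (1 - ‖M z‖ ^ 2))) := by ring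
      _ ≤ _ := by
        rw [← e]
        gcongr

/-- The Ahlfors–Schwarz lemma for the metric with density `coneDensity`. -/
lemma pullbackDensity_mul_le (hf : ∀ z ∈ Metric.ball (0 : ℂ) 1, IsRamifiedAt h k l f z)
    (hs : 0 < s) (hA : 1 ≤ A) (ha : 0 < a) (hb : 0 < b) (hc : 0 < c)
    (hsum : a + b + c + 4 * s * A = 1)
    (hka : 1 < k * a) (hlb : 1 < l * b) (hhc : 1 < h * c) {C R : ℝ} (hC : 0 ≤ C)
    (hcurv : ∀ p q : ℝ, 0 < p → 0 < q → q ≤ p + 1 → p ≤ q + 1 → 1 ≤ p + q →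
      coneDensity a b s A p q ^ 2 ≤ C * (A * (s * p ^ (s - 1) / (1 + (p ^ s) ^ 2)) ^ 2 +
        A * (s * q ^ (s - 1) / (1 + (q ^ s) ^ 2)) ^ 2))
    (hR : 0 < R) (hR1 : R < 1) {z : ℂ} (hz : ‖z‖ ≤ R) :
    (pullbackDensity a b s A f z * (R ^ 2 - ‖z‖ ^ 2)) ^ 2 ≤ C * R ^ 2 := by
  have hsA : 0 < s * A := by positivity
  set W : ℂ → ℝ := fun z => pullbackDensity a b s A f z * (R ^ 2 - ‖z‖ ^ 2) with hW
  have hmem : ∀ y : ℂ, ‖y‖ ≤ R → y ∈ Metric.ball (0 : ℂ) 1 := fun y hy => by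
    rw [mem_ball_zero_iff]; exact hy.trans_lt hR1
  have hcont : ContinuousOn W (Metric.closedBall 0 R) := by
    intro y hy
    rw [mem_closedBall_zero_iff] at hy
    exact (((hf y (hmem y hy)).continuousAt_pullbackDensity hs hA ha hb hc hsum hka hlb hhc).mul
      (continuousAt_const.sub (continuousAt_id.norm.pow 2))).continuousWithinAt
  obtain ⟨x, hx, hxmax⟩ := (isCompact_closedBall (0 : ℂ) R).exists_isMaxOn
    ⟨0, Metric.mem_closedBall_self hR.le⟩ hcont
  rw [mem_closedBall_zero_iff] at hx
  have hW0 : ∀ y, ‖y‖ ≤ R → 0 ≤ W y := fun y hy =>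
    mul_nonneg (pullbackDensity_nonneg _ _ _ _ _ _) (by nlinarith [norm_nonneg y])
  have hzx : W z ≤ W x := hxmax (mem_closedBall_zero_iff.2 hz)
  refine (pow_le_pow_left₀ (hW0 z hz) hzx 2).trans ?_
  rcases (hW0 x hx).eq_or_lt with h0 | hlt
  · rw [← h0, zero_pow two_ne_zero]; positivity
  -- The weight vanishes on the circle |z| = R and the density at ramified points, so a positive
  -- maximum avoids both.
  have hxR : ‖x‖ < R := by
    refine lt_of_le_of_ne hx fun he => ?_
    simp [hW, he] at hlt
  have hd0 : pullbackDensity a b s A f x ≠ 0 := by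
    intro he
    simp [hW, he] at hlt
  have hfx0 : f x ≠ 0 := fun he => hd0 (pullbackDensity_eq_zero_left (by linarith) he)
  have hfx1 : f x ≠ 1 := fun he => hd0 (pullbackDensity_eq_zero_right (by linarith) he)
  have hda : AnalyticAt ℂ f x := by
    rcases hf x (hmem x hx) with h | h | h | h
    · exact h.1
    · exact h.1
    · exact h.1
    · exact absurd h.2.1 hfx0
  have hder : deriv f x ≠ 0 := by
    intro he
    simp [pullbackDensity, he] at hd0
  refine hda.pullbackDensity_le_of_isLocalMax hfx0 hfx1 hder hs hA hC hcurv hxR ?_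
  exact hxmax.isLocalMax (Metric.closedBall_mem_nhds_of_mem (by simpa using hxR))

end

/-! ### The chordal metric as a distance in ℂ × ℝ -/

/-- Stereographic embedding of `ℂ ∪ {∞}` as the sphere `|w|² = t - t²` in `ℂ × ℝ`. -/
noncomputable def sphereEmbedding : OnePoint ℂ → ℂ × ℝ
  | some z => ((((1 + ‖z‖ ^ 2)⁻¹ : ℝ) : ℂ) * z, (1 + ‖z‖ ^ 2)⁻¹)
  | none => (0, 0)

lemma chordalDist_nonneg (x y : OnePoint ℂ) : 0 ≤ chordalDist x y := by
  rcases x with _ | z <;> rcases y with _ | w <;> simp only [chordalDist] <;> positivity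

/-- The embedding is isometric for the Euclidean norm. The norm of `ℂ × ℝ` is the maximum norm, so
only a two-sided comparison with it follows. -/
lemma chordalDist_sq (x y : OnePoint ℂ) : chordalDist x y ^ 2 =
    ‖(sphereEmbedding x).1 - (sphereEmbedding y).1‖ ^ 2 +
      ((sphereEmbedding x).2 - (sphereEmbedding y).2) ^ 2 := by
  rcases x with _ | z <;> rcases y with _ | w
  · simp [chordalDist, sphereEmbedding]
  · have hw : 0 < 1 + ‖w‖ ^ 2 := by positivity
    simp only [chordalDist, sphereEmbedding]
    rw [div_pow, Real.sq_sqrt hw.le, zero_sub, zero_sub, norm_neg, norm_mul, Complex.norm_real,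
      Real.norm_eq_abs, abs_of_pos (inv_pos.2 hw)]
    field_simp
    ring
  · have hz : 0 < 1 + ‖z‖ ^ 2 := by positivity
    simp only [chordalDist, sphereEmbedding]
    rw [div_pow, Real.sq_sqrt hz.le, sub_zero, sub_zero, norm_mul, Complex.norm_real,
      Real.norm_eq_abs, abs_of_pos (inv_pos.2 hz)]
    field_simp
    ring
  · have hz : 0 < 1 + ‖z‖ ^ 2 := by positivity
    have hw : 0 < 1 + ‖w‖ ^ 2 := by positivity
    simp only [chordalDist, sphereEmbedding]
    rw [div_pow, mul_pow, Real.sq_sqrt hz.le, Real.sq_sqrt hw.le]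
    have h1 : ((1 + ‖z‖ ^ 2)⁻¹ : ℝ) * z - ((1 + ‖w‖ ^ 2)⁻¹ : ℝ) * w =
        (((1 + ‖z‖ ^ 2)⁻¹ * (1 + ‖w‖ ^ 2)⁻¹ : ℝ) : ℂ) *
          (((1 + ‖w‖ ^ 2 : ℝ) : ℂ) * z - ((1 + ‖z‖ ^ 2 : ℝ) : ℂ) * w) := by
      have hz' : ((1 + ‖z‖ ^ 2 : ℝ) : ℂ) ≠ 0 := by exact_mod_cast hz.ne'
      have hw' : ((1 + ‖w‖ ^ 2 : ℝ) : ℂ) ≠ 0 := by exact_mod_cast hw.ne'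
      rw [Complex.ofReal_mul, Complex.ofReal_inv, Complex.ofReal_inv]
      field_simp
    rw [h1, norm_mul, mul_pow, Complex.norm_real, Real.norm_eq_abs, sq_abs]
    field_simp
    simp only [← Complex.normSq_eq_norm_sq, Complex.normSq_apply, Complex.sub_re, Complex.sub_im,
      Complex.mul_re, Complex.mul_im, Complex.ofReal_re, Complex.ofReal_im]
    ring

lemma norm_sphereEmbedding_sub_le (x y : OnePoint ℂ) :
    ‖sphereEmbedding x - sphereEmbedding y‖ ≤ chordalDist x y := by
  have h := chordalDist_sq x y
  have h0 := chordalDist_nonneg x y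
  rw [Prod.norm_def]
  refine max_le ?_ ?_
  · exact abs_le_of_sq_le_sq' (by rw [h]; exact le_add_of_nonneg_right (sq_nonneg _)) h0 |>.2
  · rw [Real.norm_eq_abs]
    exact abs_le_of_sq_le_sq (by rw [h]; exact le_add_of_nonneg_left (sq_nonneg _)) h0

lemma chordalDist_le_two_mul (x y : OnePoint ℂ) :
    chordalDist x y ≤ 2 * ‖sphereEmbedding x - sphereEmbedding y‖ := by
  have h := chordalDist_sq x y
  have h1 := norm_fst_le (sphereEmbedding x - sphereEmbedding y)
  have h2 := norm_snd_le (sphereEmbedding x - sphereEmbedding y)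
  refine abs_le_of_sq_le_sq' ?_ (by positivity) |>.2
  rw [h, ← sq_abs ((sphereEmbedding x).2 - _), ← Real.norm_eq_abs]
  have h3 := pow_le_pow_left₀ (norm_nonneg _) h1 2
  have h4 := pow_le_pow_left₀ (norm_nonneg _) h2 2
  simp only [Prod.fst_sub, Prod.snd_sub] at h3 h4
  nlinarith [sq_nonneg ‖sphereEmbedding x - sphereEmbedding y‖]

lemma range_sphereEmbedding :
    Set.range sphereEmbedding = {p : ℂ × ℝ | ‖p.1‖ ^ 2 = p.2 - p.2 ^ 2} := by
  ext ⟨w, t⟩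
  simp only [Set.mem_range, Set.mem_ofPred_eq]
  constructor
  · rintro ⟨_ | z, h⟩
    · simp only [sphereEmbedding, Prod.mk.injEq] at h
      simp [← h.1, ← h.2]
    · have hz : 0 < 1 + ‖z‖ ^ 2 := by positivity
      simp only [sphereEmbedding, Prod.mk.injEq] at h
      rw [← h.1, ← h.2, norm_mul, Complex.norm_real, Real.norm_eq_abs, abs_of_pos (inv_pos.2 hz)]
      field_simp
      ring
  · intro h
    rcases eq_or_ne t 0 with rfl | ht
    · refine ⟨none, ?_⟩
      have : w = 0 := by simpa using h
      simp [sphereEmbedding, this]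
    · refine ⟨some (w / t), ?_⟩
      have ht' : (t : ℂ) ≠ 0 := by exact_mod_cast ht
      have e : (1 + ‖w / (t : ℂ)‖ ^ 2)⁻¹ = t := by
        rw [norm_div, div_pow, h, Complex.norm_real, Real.norm_eq_abs, sq_abs]
        field_simp
        ring
      simp only [sphereEmbedding, e, Prod.mk.injEq, and_true]
      field_simp

lemma isCompact_range_sphereEmbedding : IsCompact (Set.range sphereEmbedding) := by
  refine Metric.isCompact_of_isClosed_isBounded ?_ ?_
  · rw [range_sphereEmbedding]
    exact isClosed_eq (by fun_prop) (by fun_prop)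
  · refine (Metric.isBounded_iff_subset_closedBall (0 : ℂ × ℝ)).2 ⟨1, fun p hp => ?_⟩
    rw [range_sphereEmbedding] at hp
    rw [mem_closedBall_zero_iff, Prod.norm_def]
    have hp' : ‖p.1‖ ^ 2 = p.2 - p.2 ^ 2 := hp
    have h0 := sq_nonneg ‖p.1‖
    refine max_le ?_ ?_
    · nlinarith [norm_nonneg p.1, sq_nonneg (p.2 - 1 / 2)]
    · rw [Real.norm_eq_abs, abs_le]
      constructor <;> nlinarith

/-! ### Infinitesimal spherical Lipschitz bounds -/

lemma deriv_eq_zero_of_two_le_analyticOrderAt {F : ℂ → ℂ} {x : ℂ} (hF : AnalyticAt ℂ F x)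
    (h : (2 : ℕ) ≤ analyticOrderAt F x) : deriv F x = 0 := by
  obtain ⟨g, hg, hFg⟩ := (natCast_le_analyticOrderAt hF).1 h
  rw [EventuallyEq.deriv_eq hFg]
  have := (((hasDerivAt_id x).sub_const x).pow 2).mul hg.differentiableAt.hasDerivAt
  exact this.deriv.trans (by simp)

lemma sphereValue_eq_coe {f : ℂ → ℂ} {z : ℂ} (hf : AnalyticAt ℂ f z) :
    sphereValue f z = (f z : OnePoint ℂ) := by
  rw [sphereValue, if_neg hf.meromorphicOrderAt_nonneg.not_gt,
    toMeromorphicNFAt_eq_self.2 hf.meromorphicNFAt]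

lemma AnalyticAt.eventually_norm_sub_le {F : ℂ → ℂ} {x : ℂ} (hF : AnalyticAt ℂ F x)
    {w : ℂ → ℝ} (hw : ContinuousAt w x) {L : ℝ} (hL : ‖deriv F x‖ * w x < L) :
    ∀ᶠ z in 𝓝 x, ‖F z - F x‖ * w z ≤ L * ‖z - x‖ := by
  have h1 := ((hasDerivAt_iff_tendsto_slope.1 hF.differentiableAt.hasDerivAt).norm.mul
    (hw.tendsto.mono_left (nhdsWithin_le_nhds (s := {x}ᶜ)))).eventually_lt_const hL
  rw [eventually_nhdsWithin_iff] at h1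
  filter_upwards [h1] with z hz
  by_cases h : z = x
  · simp [h]
  · have h2 := hz h
    have hpos : 0 < ‖z - x‖ := norm_pos_iff.2 (sub_ne_zero.2 h)
    rw [slope_def_field, norm_div, div_mul_eq_mul_div, div_lt_iff₀ hpos] at h2
    exact h2.le

lemma AnalyticAt.eventually_chordalDist_le {f : ℂ → ℂ} {x : ℂ} (hf : AnalyticAt ℂ f x) {L : ℝ}
    (hL : ‖deriv f x‖ * (1 + ‖f x‖ ^ 2)⁻¹ < L) :
    ∀ᶠ z in 𝓝 x, chordalDist (sphereValue f z) (sphereValue f x) ≤ L * ‖z - x‖ := by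
  have hw : ContinuousAt (fun z => (√(1 + ‖f z‖ ^ 2) * √(1 + ‖f x‖ ^ 2))⁻¹) x := by
    refine ContinuousAt.inv₀ (ContinuousAt.mul ?_ continuousAt_const) (by positivity)
    exact (continuousAt_const.add (hf.continuousAt.norm.pow 2)).sqrt
  have := hf.eventually_norm_sub_le hw (L := L)
    (by rwa [Real.mul_self_sqrt (by positivity)])
  filter_upwards [this, hf.eventually_analyticAt] with z hz hfz
  rw [sphereValue_eq_coe hfz, sphereValue_eq_coe hf]
  exact hz

/-- The chordal distance from w to ∞ is at most |1/w|, so the analytic function 1/f controls it. -/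
lemma eventually_chordalDist_le_of_pole {f : ℂ → ℂ} {x : ℂ} (hF : AnalyticAt ℂ f⁻¹ x)
    (h0 : f x = 0) (hneg : meromorphicOrderAt f x < 0) (hd : deriv f⁻¹ x = 0) {L : ℝ}
    (hL : 0 < L) :
    ∀ᶠ z in 𝓝 x, chordalDist (sphereValue f z) (sphereValue f x) ≤ L * ‖z - x‖ := by
  have hx : sphereValue f x = OnePoint.infty := by rw [sphereValue, if_pos hneg]
  have hne : ∀ᶠ z in 𝓝[≠] x, f⁻¹ z ≠ 0 := by
    refine hF.eventually_eq_zero_or_eventually_ne_zero.resolve_left fun h => ?_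
    have : meromorphicOrderAt f x = ⊤ := by
      rw [meromorphicOrderAt_eq_top_iff]
      exact nhdsWithin_le_nhds (h.mono fun z hz => by simpa using hz)
    simp [this] at hneg
  rw [eventually_nhdsWithin_iff] at hne
  have := hF.eventually_norm_sub_le (continuousAt_const (y := (1 : ℝ))) (L := L) (by simpa [hd])
  filter_upwards [this, hF.eventually_analyticAt, hne] with z hz hFz hz0
  by_cases hzx : z = x
  · rw [hzx, hx]
    change (0 : ℝ) ≤ _
    positivity
  have hfz : AnalyticAt ℂ f z := by simpa using hFz.inv (hz0 hzx)
  rw [hx, sphereValue_eq_coe hfz]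
  refine le_trans ?_ hz
  have hz1 : f z ≠ 0 := by simpa using hz0 hzx
  have hpos : 0 < ‖f z‖ := norm_pos_iff.2 hz1
  change 1 / √(1 + ‖f z‖ ^ 2) ≤ _
  simp only [Pi.inv_apply, h0, inv_zero, sub_zero, norm_inv, mul_one]
  rw [one_div]
  gcongr
  exact Real.le_sqrt_of_sq_le (by linarith)

section
variable {h k l : ℕ} {a b s A : ℝ} {f : ℂ → ℂ} {x : ℂ}

/-- At ramified points the density is 0 and gives no control; multiplicity at least 2 makes the
spherical derivative vanish there. -/
lemma IsRamifiedAt.eventually_chordalDist_le (hf : IsRamifiedAt h k l f x) (hh : 2 ≤ h)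
    (hk : 2 ≤ k) (hl : 2 ≤ l) {C L : ℝ}
    (hC : ∀ p q : ℝ, 0 < p → 0 < q → q ≤ p + 1 → p ≤ q + 1 → 1 ≤ p + q →
      (1 + p ^ 2)⁻¹ ≤ C * coneDensity a b s A p q)
    (hL0 : 0 < L) (hL : C * pullbackDensity a b s A f x < L) :
    ∀ᶠ z in 𝓝 x, chordalDist (sphereValue f z) (sphereValue f x) ≤ L * ‖z - x‖ := by
  have hcast : ∀ {m : ℕ} {n : ℕ∞}, 2 ≤ m → (m : ℕ∞) ≤ n → ((2 : ℕ) : ℕ∞) ≤ n :=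
    fun h1 h2 => le_trans (by exact_mod_cast h1) h2
  rcases hf with ⟨hf, h0, h1⟩ | ⟨hf, h0, hord⟩ | ⟨hf, h1, hord⟩ | ⟨hF, h0, hord, hneg⟩
  · refine hf.eventually_chordalDist_le (lt_of_le_of_lt ?_ hL)
    have := hC ‖f x‖ ‖f x - 1‖ (norm_pos_iff.2 h0) (norm_pos_iff.2 (sub_ne_zero.2 h1))
      ((norm_sub_le _ _).trans_eq (by simp)) (by simpa using norm_add_le (f x - 1) 1)
      (by simpa using norm_sub_le (f x) (f x - 1))
    unfold pullbackDensity
    calc _ ≤ ‖deriv f x‖ * (C * coneDensity a b s A ‖f x‖ ‖f x - 1‖) := by gcongr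
      _ = _ := by ring
  · refine hf.eventually_chordalDist_le ?_
    rw [deriv_eq_zero_of_two_le_analyticOrderAt hf (hcast hk hord)]
    simpa
  · refine hf.eventually_chordalDist_le ?_
    have := deriv_eq_zero_of_two_le_analyticOrderAt (hf.sub analyticAt_const) (hcast hl hord)
    have hd : deriv (f - fun _ => (1 : ℂ)) x = deriv f x := deriv_sub_const 1
    rw [← hd, this]
    simpa
  · exact eventually_chordalDist_le_of_pole hF h0 hneg
      (deriv_eq_zero_of_two_le_analyticOrderAt hF (hcast hh hord)) hL0

end

/-! ### From local Lipschitz bounds to convergent subsequences -/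

/-- A function which is infinitesimally `L`-Lipschitz on a convex set is `L`-Lipschitz there. -/
lemma Convex.norm_sub_le_of_eventually_norm_sub_le {E E' : Type*} [NormedAddCommGroup E]
    [NormedSpace ℝ E] [NormedAddCommGroup E'] {S : E → E'} {s : Set E} (hs : Convex ℝ s) {L : ℝ}
    (hS : ∀ x ∈ s, ∀ L' > L, ∀ᶠ z in 𝓝 x, ‖S z - S x‖ ≤ L' * ‖z - x‖) {x y : E}
    (hx : x ∈ s) (hy : y ∈ s) : ‖S y - S x‖ ≤ L * ‖y - x‖ := by
  rcases eq_or_ne x y with rfl | hxy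
  · simp
  have hpos : 0 < ‖y - x‖ := norm_pos_iff.2 (sub_ne_zero.2 hxy.symm)
  rw [← div_le_iff₀ hpos]
  refine le_of_forall_gt_imp_ge_of_dense fun L' hL' => ?_
  rw [div_le_iff₀ hpos]
  obtain ⟨L'', h1, h2⟩ := exists_between hL'
  set γ : ℝ → E := fun t => x + t • (y - x) with hγ
  have hγs : ∀ t ∈ Set.Icc (0 : ℝ) 1, γ t ∈ s := fun t ht =>
    hs.add_smul_sub_mem hx hy ht
  have hγc : Continuous γ := by fun_prop
  have hγd : ∀ t u, ‖γ u - γ t‖ = |u - t| * ‖y - x‖ := by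
    intro t u
    rw [hγ, ← Real.norm_eq_abs, ← norm_smul]
    congr 1
    module
  have hloc : ∀ t ∈ Set.Icc (0 : ℝ) 1, ∀ᶠ u in 𝓝 t,
      ‖S (γ u) - S (γ t)‖ ≤ L'' * (|u - t| * ‖y - x‖) := by
    intro t ht
    filter_upwards [hγc.continuousAt.eventually (hS (γ t) (hγs t ht) L'' h1)] with u hu
    rwa [hγd] at hu
  have hcont : ContinuousOn (fun t => ‖S (γ t) - S x‖) (Set.Icc 0 1) := by
    intro t ht
    refine ContinuousAt.continuousWithinAt ?_
    have : ContinuousAt (fun u => S (γ u)) t := by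
      rw [ContinuousAt, tendsto_iff_norm_sub_tendsto_zero]
      refine squeeze_zero' (Eventually.of_forall fun _ => norm_nonneg _) (hloc t ht) ?_
      have : Continuous fun u : ℝ => L'' * (|u - t| * ‖y - x‖) := by fun_prop
      simpa using this.tendsto t
    exact (this.sub continuousAt_const).norm
  have := image_le_of_liminf_slope_right_lt_deriv_boundary (f := fun t => ‖S (γ t) - S x‖)
    (f' := fun _ => L'' * ‖y - x‖) (B := fun t => L' * ‖y - x‖ * t) (B' := fun _ => L' * ‖y - x‖)
    hcont ?_ (by simp [hγ]) (fun t => by simpa using (hasDerivAt_id t).const_mul (L' * ‖y - x‖))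
    (fun t _ _ => by gcongr) (Set.right_mem_Icc.2 zero_le_one)
  · simpa [hγ] using this
  · intro t ht r hr
    refine Eventually.frequently ?_
    filter_upwards [self_mem_nhdsWithin, nhdsWithin_le_nhds (hloc t ⟨ht.1, ht.2.le⟩)] with u hu hle
    have hut : 0 < u - t := sub_pos.2 hu
    refine lt_of_le_of_lt ?_ hr
    rw [slope_def_field, div_le_iff₀ hut]
    have := norm_sub_norm_le (S (γ u) - S x) (S (γ t) - S x)
    rw [sub_sub_sub_cancel_right] at this
    rw [abs_of_pos hut] at hle
    linarith

/-- Arzelà–Ascoli for sequences of maps on the unit disc with values in a compact set which are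
uniformly Lipschitz on smaller discs. -/
lemma exists_subseq_tendstoUniformlyOn_ball {E : Type*} [NormedAddCommGroup E] [CompleteSpace E]
    {S : ℕ → ℂ → E} {K : Set E} (hK : IsCompact K) (hS : ∀ n z, S n z ∈ K)
    (hLip : ∀ r < (1 : ℝ), ∃ L, 0 < L ∧ ∀ n, ∀ x y : ℂ, ‖x‖ ≤ r → ‖y‖ ≤ r →
      ‖S n y - S n x‖ ≤ L * ‖y - x‖) :
    ∃ φ : ℕ → ℕ, StrictMono φ ∧ ∃ G : ℂ → E, (∀ z, G z ∈ K) ∧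
      ∀ Q ⊆ Metric.ball (0 : ℂ) 1, IsCompact Q →
        TendstoUniformlyOn (fun n => S (φ n)) G atTop Q := by
  -- Tychonoff over a dense sequence replaces the diagonal argument.
  obtain ⟨w₀, -, φ, hφ, hlim⟩ := (isCompact_univ_pi fun _ : ℕ => hK).tendsto_subseq
    (x := fun n i => S n (TopologicalSpace.denseSeq ℂ i)) (fun n i _ => hS n _)
  rw [tendsto_pi_nhds] at hlim
  have hconv : ∀ z ∈ Metric.ball (0 : ℂ) 1, ∃ w ∈ K, Tendsto (fun n => S (φ n) z) atTop (𝓝 w) := by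
    intro z hz
    rw [mem_ball_zero_iff] at hz
    obtain ⟨r, hzr, hr⟩ := exists_between hz
    obtain ⟨L, hL, hLip⟩ := hLip r hr
    have hc : CauchySeq fun n => S (φ n) z := by
      rw [Metric.cauchySeq_iff']
      intro ε hε
      obtain ⟨i, hd⟩ := (TopologicalSpace.denseRange_denseSeq ℂ).exists_dist_lt z
        (ε := min (r - ‖z‖) (ε / (4 * L))) (lt_min (by linarith) (by positivity))
      set d := TopologicalSpace.denseSeq ℂ i
      rw [dist_comm, dist_eq_norm, lt_min_iff, lt_div_iff₀ (by positivity)] at hd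
      have hdr : ‖d‖ ≤ r := by
        have := norm_sub_norm_le d z
        linarith [hd.1]
      obtain ⟨N, hN⟩ := Metric.cauchySeq_iff'.1 (hlim i).cauchySeq (ε / 2) (by positivity)
      refine ⟨N, fun n hn => ?_⟩
      have h1 := hN n hn
      have h2 := hLip (φ n) d z hdr hzr.le
      have h3 := hLip (φ N) z d hzr.le hdr
      rw [← dist_eq_norm] at h2 h3
      rw [norm_sub_rev] at h2
      calc dist (S (φ n) z) (S (φ N) z) ≤ dist (S (φ n) z) (S (φ n) d) +
            dist (S (φ n) d) (S (φ N) d) + dist (S (φ N) d) (S (φ N) z) := dist_triangle4 _ _ _ _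
        _ < L * ‖d - z‖ + ε / 2 + L * ‖d - z‖ := by
          have h1' : dist (S (φ n) d) (S (φ N) d) < ε / 2 := h1
          linarith
        _ ≤ ε := by nlinarith [hd.2]
    obtain ⟨w, hw⟩ := cauchySeq_tendsto_of_complete hc
    exact ⟨w, hK.isClosed.mem_of_tendsto hw (Eventually.of_forall fun n => hS _ _), hw⟩
  classical
  choose! G hGK hG using hconv
  -- Off the disc any point of K will do; values in K everywhere allow the limit to be lifted back
  -- to the sphere.
  refine ⟨φ, hφ, fun z => if z ∈ Metric.ball (0 : ℂ) 1 then G z else S 0 0, fun z => ?_,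
    fun Q hQ hQc => ?_⟩
  · dsimp only
    split_ifs with hz
    · exact hGK z hz
    · exact hS _ _
  have hbound : ∃ r < (1 : ℝ), ∀ z ∈ Q, ‖z‖ ≤ r := by
    rcases Q.eq_empty_or_nonempty with rfl | hne
    · exact ⟨0, one_pos, by simp⟩
    · obtain ⟨z, hz, hmax⟩ := hQc.exists_isMaxOn hne continuous_norm.continuousOn
      exact ⟨‖z‖, by simpa using hQ hz, fun y hy => hmax hy⟩
  obtain ⟨r, hr, hQr⟩ := hbound
  obtain ⟨L, hL, hLip⟩ := hLip r hr
  have heq : EquicontinuousOn (fun n => S (φ n)) Q := by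
    intro x hx U hU
    obtain ⟨ε, hε, hεU⟩ := Metric.mem_uniformity_dist.1 hU
    have : Metric.ball x (ε / L) ∈ 𝓝 x := Metric.ball_mem_nhds x (by positivity)
    filter_upwards [self_mem_nhdsWithin, nhdsWithin_le_nhds this] with y hy hyx n
    refine hεU ?_
    rw [Metric.mem_ball, lt_div_iff₀ hL, dist_eq_norm] at hyx
    rw [dist_comm, dist_eq_norm]
    exact (hLip (φ n) x y (hQr x hx) (hQr y hy)).trans_lt (by linarith)
  have key := (EquicontinuousOn.tendsto_uniformOnFun_iff_pi' (𝔖 := {Q})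
    (by simpa using hQc) (by simpa using heq) atTop
    (fun z => if z ∈ Metric.ball (0 : ℂ) 1 then G z else S 0 0)).2 (by
      rw [tendsto_pi_nhds]
      rintro ⟨z, hz⟩
      have hzQ : z ∈ Q := by simpa using hz
      have := hG z (hQ hzQ)
      simp only [Set.domRestrict_apply, Function.comp_apply, if_pos (hQ hzQ)]
      exact this)
  exact UniformOnFun.tendsto_iff_tendstoUniformlyOn.1 key Q rfl

/-! ### Multiplicity hypotheses and the conclusion -/

section
variable {h k l : ℕ} {f : ℂ → ℂ} {x : ℂ}

lemma AnalyticAt.le_analyticOrderAt_of_le_meromorphicOrderAt {m : ℕ} (hf : AnalyticAt ℂ f x)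
    (hm : ((m : ℤ) : WithTop ℤ) ≤ meromorphicOrderAt f x) : (m : ℕ∞) ≤ analyticOrderAt f x := by
  rw [hf.meromorphicOrderAt_eq] at hm
  cases hn : analyticOrderAt f x with
  | top => exact le_top
  | coe n =>
    rw [hn, ENat.map_natCast] at hm
    exact_mod_cast hm

lemma AnalyticAt.meromorphicOrderAt_pos (hf : AnalyticAt ℂ f x) (h0 : f x = 0) :
    0 < meromorphicOrderAt f x := by
  refine lt_of_le_of_ne hf.meromorphicOrderAt_nonneg fun h => ?_
  exact (hf.meromorphicNFAt.meromorphicOrderAt_eq_zero_iff.1 h.symm) h0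

lemma MeromorphicNFAt.isRamifiedAt (hf : MeromorphicNFAt f x)
    (hpole : meromorphicOrderAt f x < 0 →
      meromorphicOrderAt f x ≤ ((-(h : ℤ) : ℤ) : WithTop ℤ))
    (hzero : 0 < meromorphicOrderAt f x → ((k : ℤ) : WithTop ℤ) ≤ meromorphicOrderAt f x)
    (hone : 0 < meromorphicOrderAt (fun w => f w - 1) x →
      ((l : ℤ) : WithTop ℤ) ≤ meromorphicOrderAt (fun w => f w - 1) x) :
    IsRamifiedAt h k l f x := by
  rcases meromorphicNFAt_iff_analyticAt_or.1 hf with ha | ⟨-, hneg, h0⟩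
  · by_cases h0 : f x = 0
    · exact Or.inr (Or.inl ⟨ha, h0,
        ha.le_analyticOrderAt_of_le_meromorphicOrderAt (hzero (ha.meromorphicOrderAt_pos h0))⟩)
    by_cases h1 : f x = 1
    · have ha1 : AnalyticAt ℂ (fun w => f w - 1) x := ha.sub analyticAt_const
      exact Or.inr (Or.inr (Or.inl ⟨ha, h1, ha1.le_analyticOrderAt_of_le_meromorphicOrderAt
        (hone (ha1.meromorphicOrderAt_pos (by simp [h1])))⟩))
    · exact Or.inl ⟨ha, h0, h1⟩
  · have hord : ((h : ℤ) : WithTop ℤ) ≤ meromorphicOrderAt f⁻¹ x := by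
      have hle := hpole hneg
      rw [meromorphicOrderAt_inv]
      lift meromorphicOrderAt f x to ℤ using hneg.ne_top with n
      rw [WithTop.coe_le_coe] at hle
      change ((h : ℤ) : WithTop ℤ) ≤ ((-n : ℤ) : WithTop ℤ)
      rw [WithTop.coe_le_coe]
      omega
    have hF : AnalyticAt ℂ f⁻¹ x := by
      refine hf.inv.meromorphicOrderAt_nonneg_iff_analyticAt.1 (le_trans ?_ hord)
      exact_mod_cast Int.natCast_nonneg h
    exact Or.inr (Or.inr (Or.inr ⟨hF, h0,
      hF.le_analyticOrderAt_of_le_meromorphicOrderAt hord, hneg⟩))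

/-- Uniform spherical Lipschitz bound for functions with ramified values. -/
lemma exists_norm_sphereEmbedding_sub_le (hh : 2 ≤ h) (hk : 2 ≤ k) (hl : 2 ≤ l)
    (hμ : (1 : ℝ) / h + 1 / k + 1 / l < 1) {r : ℝ} (hr : r < 1) :
    ∃ L : ℝ, 0 < L ∧ ∀ f : ℂ → ℂ, (∀ z ∈ Metric.ball (0 : ℂ) 1, IsRamifiedAt h k l f z) →
      ∀ x y : ℂ, ‖x‖ ≤ r → ‖y‖ ≤ r →
        ‖sphereEmbedding (sphereValue f y) - sphereEmbedding (sphereValue f x)‖ ≤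
          L * ‖y - x‖ := by
  -- The defect is split into four: one quarter for each of a, b, c, and one for 4sA with s = ε/4, A
  -- = 1.
  set ε : ℝ := (1 - (1 / h + 1 / k + 1 / l)) / 4 with hε
  have hε0 : 0 < ε := by rw [hε]; linarith
  have hh0 : (0 : ℝ) < h := by exact_mod_cast (by omega : 0 < h)
  have hk0 : (0 : ℝ) < k := by exact_mod_cast (by omega : 0 < k)
  have hl0 : (0 : ℝ) < l := by exact_mod_cast (by omega : 0 < l)
  have hhi : 0 < 1 / (h : ℝ) := by positivity
  have hki : 0 < 1 / (k : ℝ) := by positivity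
  have hli : 0 < 1 / (l : ℝ) := by positivity
  have hmul : ∀ m : ℝ, 0 < m → 1 < m * (1 / m + ε) := by
    intro m hm
    rw [mul_add, mul_one_div_cancel hm.ne']
    have := mul_pos hm hε0
    linarith
  have hsum : (1 / k + ε) + (1 / l + ε) + (1 / h + ε) + 4 * (ε / 4) * 1 = 1 := by
    rw [hε]; ring
  obtain ⟨C₁, hC₁, hcurv⟩ := exists_coneDensity_sq_le (a := 1 / k + ε) (b := 1 / l + ε)
    (c := 1 / h + ε) (s := ε / 4) (A := 1) (by linarith) le_rfl (by linarith) (by linarith)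
    (by linarith) hsum
  obtain ⟨C₂, hC₂, hsph⟩ := exists_inv_le_coneDensity (a := 1 / k + ε) (b := 1 / l + ε)
    (c := 1 / h + ε) (s := ε / 4) (A := 1) (by linarith) le_rfl (by linarith) (by linarith)
    (by linarith) hsum
  obtain ⟨ρ, hρ, hρ1⟩ := exists_between (max_lt hr one_pos)
  obtain ⟨R, hR, hR1⟩ := exists_between hρ1
  have hρ0 : 0 < ρ := (le_max_right _ _).trans_lt hρ
  have hrρ : r ≤ ρ := ((le_max_left _ _).trans_lt hρ).le
  have hgap : 0 < R ^ 2 - ρ ^ 2 := by nlinarith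
  set V : ℝ := √C₁ * R / (R ^ 2 - ρ ^ 2) with hV
  have hR0 : 0 < R := hρ0.trans hR
  have hV0 : 0 < V := by positivity
  refine ⟨C₂ * V, by positivity, fun f hf x y hx hy => ?_⟩
  have hbound : ∀ z : ℂ, ‖z‖ ≤ ρ →
      pullbackDensity (1 / k + ε) (1 / l + ε) (ε / 4) 1 f z ≤ V := by
    intro z hz
    have h1 := pullbackDensity_mul_le hf (by linarith) le_rfl (by linarith) (by linarith)
      (by linarith) hsum (hmul _ hk0) (hmul _ hl0) (hmul _ hh0) hC₁.le hcurv hR0 hR1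
      (hz.trans hR.le)
    have h2 := pullbackDensity_nonneg (1 / k + ε) (1 / l + ε) (ε / 4) 1 f z
    have h3 : R ^ 2 - ρ ^ 2 ≤ R ^ 2 - ‖z‖ ^ 2 := by
      have := pow_le_pow_left₀ (norm_nonneg z) hz 2
      linarith
    rw [hV, le_div_iff₀ hgap]
    refine (mul_le_mul_of_nonneg_left h3 h2).trans (abs_le_of_sq_le_sq' ?_ (by positivity)).2
    rw [mul_pow √C₁, Real.sq_sqrt hC₁.le]
    exact h1
  refine Convex.norm_sub_le_of_eventually_norm_sub_le
    (S := fun z => sphereEmbedding (sphereValue f z)) (convex_closedBall (0 : ℂ) ρ)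
    (fun z hz L' hL' => ?_) (mem_closedBall_zero_iff.2 (hx.trans hrρ))
    (mem_closedBall_zero_iff.2 (hy.trans hrρ))
  rw [mem_closedBall_zero_iff] at hz
  have hL0 : 0 < L' := lt_trans (by positivity) hL'
  have := (hf z (mem_ball_zero_iff.2 (hz.trans_lt hρ1))).eventually_chordalDist_le hh hk hl hsph
    hL0 (lt_of_le_of_lt (mul_le_mul_of_nonneg_left (hbound z hz) hC₂.le) hL')
  filter_upwards [this] with w hw
  exact (norm_sphereEmbedding_sub_le _ _).trans hw

end

lemma sphereValue_toMeromorphicNFOn {f : ℂ → ℂ} {U : Set ℂ} (hf : MeromorphicOn f U) {z : ℂ}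
    (hz : z ∈ U) : sphereValue (toMeromorphicNFOn f U) z = sphereValue f z := by
  unfold sphereValue
  rw [meromorphicOrderAt_toMeromorphicNFOn hf hz,
    toMeromorphicNFAt_eq_self.2 (meromorphicNFOn_toMeromorphicNFOn f U hz),
    toMeromorphicNFOn_eq_toMeromorphicNFAt hf hz]

lemma two_le_of_one_div_lt_one {m : ℕ} (hm : 0 < m) (h : (1 : ℝ) / m < 1) : 2 ≤ m := by
  rw [div_lt_one (by exact_mod_cast hm)] at h
  exact_mod_cast h

theorem mainTheorem5 (h k l : ℕ) (hh : 0 < h) (hk : 0 < k) (hl : 0 < l)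
    (hμ : (1 : ℝ) / h + 1 / k + 1 / l < 1)
    (F : Set (ℂ → ℂ))
    (hF : ∀ f ∈ F, MeromorphicOn f (Metric.ball (0 : ℂ) 1))
    (hpoles : ∀ f ∈ F, ∀ z ∈ Metric.ball (0 : ℂ) 1, meromorphicOrderAt f z < 0 →
      meromorphicOrderAt f z ≤ ((-(h : ℤ) : ℤ) : WithTop ℤ))
    (hzeros : ∀ f ∈ F, ∀ z ∈ Metric.ball (0 : ℂ) 1, 0 < meromorphicOrderAt f z →
      ((k : ℤ) : WithTop ℤ) ≤ meromorphicOrderAt f z)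
    (hones : ∀ f ∈ F, ∀ z ∈ Metric.ball (0 : ℂ) 1, 0 < meromorphicOrderAt (fun w => f w - 1) z →
      ((l : ℤ) : WithTop ℤ) ≤ meromorphicOrderAt (fun w => f w - 1) z) :
    IsNormalFamily F (Metric.ball (0 : ℂ) 1) := by
  intro f hf
  have hhi : 0 < 1 / (h : ℝ) := by positivity
  have hki : 0 < 1 / (k : ℝ) := by positivity
  have hli : 0 < 1 / (l : ℝ) := by positivity
  have hh2 := two_le_of_one_div_lt_one hh (by linarith)
  have hk2 := two_le_of_one_div_lt_one hk (by linarith)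
  have hl2 := two_le_of_one_div_lt_one hl (by linarith)
  -- Normal form fixes the values at removable points and poles without changing orders or sphere
  -- values on the disc.
  set g : ℕ → ℂ → ℂ := fun n => toMeromorphicNFOn (f n) (Metric.ball 0 1) with hg
  have hram : ∀ n, ∀ z ∈ Metric.ball (0 : ℂ) 1, IsRamifiedAt h k l (g n) z := by
    intro n z hz
    have hm := hF _ (hf n)
    have e1 : meromorphicOrderAt (g n) z = meromorphicOrderAt (f n) z :=
      meromorphicOrderAt_toMeromorphicNFOn hm hz
    have e2 : meromorphicOrderAt (fun w => g n w - 1) z =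
        meromorphicOrderAt (fun w => f n w - 1) z :=
      meromorphicOrderAt_congr ((hm.toMeromorphicNFOn_eq_self_on_nhdsNE hz).sub
        (EventuallyEq.refl _ fun _ => (1 : ℂ)))
    refine (meromorphicNFOn_toMeromorphicNFOn (f n) _ hz).isRamifiedAt ?_ ?_ ?_
    · rw [e1]; exact hpoles _ (hf n) z hz
    · rw [e1]; exact hzeros _ (hf n) z hz
    · rw [e2]; exact hones _ (hf n) z hz
  obtain ⟨φ, hφ, G, hGK, hG⟩ := exists_subseq_tendstoUniformlyOn_ball
    (S := fun n z => sphereEmbedding (sphereValue (g n) z)) isCompact_range_sphereEmbedding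
    (fun n z => Set.mem_range_self _) (fun r hr => by
      obtain ⟨L, hL, h⟩ := exists_norm_sphereEmbedding_sub_le hh2 hk2 hl2 hμ hr
      exact ⟨L, hL, fun n => h (g n) (hram n)⟩)
  choose u hu using hGK
  refine ⟨φ, hφ, u, fun K hK hKc ε hε => ?_⟩
  have := Metric.tendstoUniformlyOn_iff.1 (hG K hK hKc) (ε / 2) (by positivity)
  obtain ⟨N, hN⟩ := eventually_atTop.1 this
  refine ⟨N, fun n hn z hz => ?_⟩
  have h1 := hN n hn.le z hz
  rw [← hu z, dist_comm, dist_eq_norm, hg, sphereValue_toMeromorphicNFOn (hF _ (hf _)) (hK hz)]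
    at h1
  exact (chordalDist_le_two_mul _ _).trans_lt (by linarith)
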